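/- Let $G=(V,E)$ be a finite directed graph, $E\subset V\times V$, without loops; the edge $e=(x,y)$ has origin $\underline e=x$ and destination $\overline e=y$. Let $V=U\sqcup\{\delta\}$ and $x_0\in U$ be such that no edge has origin $\delta$, for every $x\in U$ there is a directed simple path from $x$ to $\delta$, and for every $x\in U$, $x\ne x_0$, there is a directed simple path from $x_0$ to $x$. Simple paths and simple cycles are sets of distinct edges $\{e_1,\dots,e_k\}$ running through distinct vertices, the edges being allowed to be traversed in either direction (a path or cycle is directed if all its edges are traversed in their own direction). A spanning tree is a set $T\subset E$ that contains no simple cycle and contains a simple path between any two distinct vertices; $\mathcal T$ is the set of spanning trees. Let $\mathcal H=\{z\in\mathbb R^E:\ \sum_{\underline e=x}z_e-\sum_{\overline e=x}z_e=\mathbf 1_{x=x_0}\ \text{for all } x\in U\}$ and $\Delta=\{z\in\mathcal H:\ z_e>0\ \text{for all } e\in E\}$. For $T\in\mathcal T$ the functions $(z_e)_{e\in T^c}$ are affine coordinates on $\mathcal H$; put $\omega_T=\bigwedge_{e\in T^c}\frac{dz_e}{z_e}$, ordered so that it is positively oriented on $\Delta$. Let $(\alpha_e)_{e\in E}$ be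 real weights such that the integrals $$I_{\Delta,T}(\lambda)=\int_\Delta e^{-\langle\lambda,z\rangle}\prod_{e\in E}z_e^{\alpha_e}\,\omega_T,\qquad \langle\lambda,z\rangle=\sum_{e\in E}\lambda_e z_e,$$ converge absolutely for all $T\in\mathcal T$ and all $\lambda\in\mathbb C^E$ with $\Re\lambda_e>0$ for all $e$. Give each simple cycle $C$ an arbitrary orientation, and let $\epsilon_C(e)=\pm1$ according to whether $e\in C$ is directed along or against it; let $\epsilon_C(e,e')=\epsilon_C(e)\epsilon_C(e')$. For a simple path $\sigma$ from $x_0$ to $\delta$ let $\epsilon_\sigma(e)=\pm1$ according to whether $e\in\sigma$ is directed from $x_0$ towards $\delta$ along $\sigma$ or not. Put $l_C(\lambda)=\sum_{e\in C}\epsilon_C(e)\lambda_e$, $l_\sigma(\lambda)=\sum_{e\in\sigma}\epsilon_\sigma(e)\lambda_e$, and $M=\mathbb C^E\setminus\bigcup_C\ker l_C$. Let $(f_T)_{T\in\mathcal T}$ be the canonical basis of $\mathbb R^{\mathcal T}$. Let $\Omega_\sigma f_T=f_T$ if $\sigma\subset T$ and $\Omega_\sigma f_T=0$ otherwise. Let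 $$\Omega_C f_T=\sum_{e\in C}\epsilon_C(e_0,e)\,\alpha_e\,f_{T\cup\{e_0\}\setminus\{e\}}$$ if there is an edge $e_0\in T^c$ (necessarily unique and in $C$) with $C\subset T\cup\{e_0\}$, and $\Omega_C f_T=0$ otherwise. Identify an endomorphism $A$ of $\mathbb R^{\mathcal T}$ with the $\mathcal T\times\mathcal T$ matrix whose row of index $T$ consists of the coordinates of $A f_T$, i.e. $A f_T=\sum_{T'}A_{T,T'}f_{T'}$, and let it act on vectors by $(AI)_T=\sum_{T'}A_{T,T'}I_{T'}$. Then on $M\cap\{\lambda:\Re\lambda_e>0\ \text{for all } e\in E\}$ the vector $I_\Delta=(I_{\Delta,T})_{T\in\mathcal T}$ is complex differentiable in $\lambda$ and satisfies $$dI_\Delta(\lambda)=-\Omega\,I_\Delta(\lambda),\qquad \Omega=\sum_\sigma dl_\sigma\,\Omega_\sigma+\sum_C\frac{dl_C}{l_C(\lambda)}\,\Omega_C,$$ where $\sigma$ runs over the simple paths from $x_0$ to $\delta$ and $C$ over the simple cycles of $G$. -/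

import Mathlib

/-- A simple directed graph without loops whose edge set is a finite set of ordered pairs,
with a cemetery vertex `δ` and a base point `x₀`. The edge `(x, y)` has origin `x` and
destination `y`. The paths to and from the special vertices are required in `RootedGraph`. -/
structure PreGraph (V : Type*) where
  edges : Finset (V × V)
  δ : V
  x₀ : V
  x₀_ne_δ : x₀ ≠ δ
  no_loop : ∀ x, (x, x) ∉ edges
  no_edge_from_δ : ∀ y, (δ, y) ∉ edges

namespace PreGraph

variable {V : Type*} (G : PreGraph V)

/-- The type of edges. -/
abbrev Edge : Type _ := {e : V × V // e ∈ G.edges}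

noncomputable instance instDecidableEqEdge : DecidableEq G.Edge := Classical.decEq _

/-- `e = (x, y)` or `e = (y, x)`. -/
def Joins (e : G.Edge) (x y : V) : Prop := e.1 = (x, y) ∨ e.1 = (y, x)

/-- The list of distinct vertices `v 0 = x, …, v k = y` and the list of edges `e 0, …, e (k-1)`
exhibit `σ` as the edge set of a simple path from `x` to `y`. -/
structure IsPathList (x y : V) (σ : Finset G.Edge) {k : ℕ}
    (v : Fin (k + 1) → V) (e : Fin k → G.Edge) : Prop where
  inj : Function.Injective v
  start : v 0 = x
  finish : v (Fin.last k) = y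
  joins : ∀ j, G.Joins (e j) (v j.castSucc) (v j.succ)
  image_eq : σ = Finset.univ.image e

/-- `σ` is (the edge set of) a simple path from `x` to `y`, edges being used in any direction. -/
def IsSimplePath (x y : V) (σ : Finset G.Edge) : Prop :=
  ∃ (k : ℕ) (v : Fin (k + 1) → V) (e : Fin k → G.Edge), G.IsPathList x y σ v e

/-- `σ` is a directed simple path from `x` to `y`. -/
def IsDirectedPath (x y : V) (σ : Finset G.Edge) : Prop :=
  ∃ (k : ℕ) (v : Fin (k + 1) → V) (e : Fin k → G.Edge), G.IsPathList x y σ v e ∧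
    ∀ j, (e j).1 = (v j.castSucc, v j.succ)

open scoped Classical in
/-- For `e` in the simple path `σ` from `x` to `y`: `1` if `e` is traversed along its own direction
when going from `x` to `y`, and `-1` otherwise. -/
noncomputable def pathSign (x y : V) (σ : Finset G.Edge) (a : G.Edge) : ℤ :=
  if ∃ (k : ℕ) (v : Fin (k + 1) → V) (e : Fin k → G.Edge), G.IsPathList x y σ v e ∧
      ∃ j, e j = a ∧ a.1 = (v j.castSucc, v j.succ) then 1 else -1

/-- The distinct vertices `v 0, …, v k` and distinct edges `e 0, …, e k` exhibit `C` as the edge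
set of a simple cycle (`j + 1` is cyclic, so the last edge joins `v k` to `v 0`). -/
structure IsCycleList (C : Finset G.Edge) {k : ℕ}
    (v : Fin (k + 1) → V) (e : Fin (k + 1) → G.Edge) : Prop where
  inj_vertices : Function.Injective v
  inj_edges : Function.Injective e
  joins : ∀ j, G.Joins (e j) (v j) (v (j + 1))
  image_eq : C = Finset.univ.image e

/-- `C` is (the edge set of) a simple cycle, edges being used in any direction. -/
def IsCycle (C : Finset G.Edge) : Prop :=
  ∃ (k : ℕ) (v : Fin (k + 1) → V) (e : Fin (k + 1) → G.Edge), G.IsCycleList C v e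

open scoped Classical in
/-- `ε` is the sign function on `C` given by one of the orientations of the cycle `C`: `1` on edges
directed according to the orientation and `-1` on edges directed in opposition to it. -/
def IsCycleOrientation (C : Finset G.Edge) (ε : G.Edge → ℤ) : Prop :=
  ∃ (k : ℕ) (v : Fin (k + 1) → V) (e : Fin (k + 1) → G.Edge), G.IsCycleList C v e ∧
    ∀ j, ε (e j) = if (e j).1 = (v j, v (j + 1)) then 1 else -1

/-- A spanning tree: no cycle, and a simple path between any two vertices. -/
def IsSpanningTree (T : Finset G.Edge) : Prop :=
  (∀ C, G.IsCycle C → ¬ C ⊆ T) ∧ ∀ x y : V, x ≠ y → ∃ σ, G.IsSimplePath x y σ ∧ σ ⊆ T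

/-- The set of spanning trees. -/
abbrev SpanningTree : Type _ := {T : Finset G.Edge // G.IsSpanningTree T}

noncomputable instance instFintypeSpanningTree : Fintype G.SpanningTree := Fintype.ofFinite _

noncomputable instance instDecidableEqSpanningTree : DecidableEq G.SpanningTree := Classical.decEq _

open scoped Classical in
/-- The divergence `div θ (x) = ∑_{e from x} θ_e - ∑_{e to x} θ_e`. -/
noncomputable def div (θ : G.Edge → ℝ) (x : V) : ℝ :=
  ∑ e : G.Edge with e.1.1 = x, θ e - ∑ e : G.Edge with e.1.2 = x, θ e

open scoped Classical in
/-- The affine space of all `z` with `div z = δ_{x₀}` on `U = V \ {δ}`. -/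
def affineSpace : Set (G.Edge → ℝ) :=
  {z | ∀ x, x ≠ G.δ → G.div z x = if x = G.x₀ then 1 else 0}

/-- The chamber `Δ` of the affine space on which all `z_e` are positive. -/
def chamber : Set G.affineSpace := {z | ∀ e, 0 < z.1 e}

/-- The measure `|dz_{e₁} ∧ ⋯ ∧ dz_{e_n}|` on the affine space, where `{e₁, …, e_n}` is the complement
of the spanning tree `T`: Lebesgue measure read in the coordinates `(z_e)_{e ∉ T}`, which
are global affine coordinates of the affine space. -/
noncomputable def coordVolume (T : Finset G.Edge) : MeasureTheory.Measure G.affineSpace :=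
  MeasureTheory.Measure.comap
    (fun (z : G.affineSpace) (e : {e : G.Edge // e ∉ T}) => z.1 e.1) MeasureTheory.volume

/-- The density with respect to `coordVolume T` of
`exp (-⟨λ, z⟩) ∏_e z_e ^ α_e ω_T`, where `ω_T = ∧_{e ∉ T} dz_e / z_e`. -/
noncomputable def integrand (α : G.Edge → ℝ) (T : Finset G.Edge) (l : G.Edge → ℂ)
    (z : G.affineSpace) : ℂ :=
  Complex.exp (-∑ e, l e * (z.1 e : ℂ)) *
    (((∏ e, (z.1 e) ^ (α e)) * ∏ e ∈ Tᶜ, (z.1 e)⁻¹ : ℝ) : ℂ)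

/-- The domain `{Re λ_e > 0 for all e}`. -/
def rightDomain : Set (G.Edge → ℂ) := {l | ∀ e, 0 < (l e).re}

/-- The integrals `I_{Δ,T}(λ)` are well-defined (absolutely convergent), for all spanning trees `T`
and all `λ` with positive real parts. -/
def IntegralsWellDefined (α : G.Edge → ℝ) : Prop :=
  ∀ T : G.SpanningTree, ∀ l ∈ G.rightDomain,
    MeasureTheory.IntegrableOn (G.integrand α T.1 l) G.chamber (G.coordVolume T.1)

/-- The vector `I_Δ(λ) = (I_{Δ,T}(λ))_T`. -/
noncomputable def hyperInt (α : G.Edge → ℝ) (l : G.Edge → ℂ) : G.SpanningTree → ℂ :=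
  fun T => ∫ z in G.chamber, G.integrand α T.1 l z ∂(G.coordVolume T.1)

/-- The linear form `λ ↦ ∑_{e ∈ S} ε(e) λ_e`. -/
noncomputable def linForm (S : Finset G.Edge) (ε : G.Edge → ℤ) : (G.Edge → ℂ) →ₗ[ℂ] ℂ :=
  ∑ e ∈ S, (ε e : ℂ) • LinearMap.proj e

/-- The complement `M` of the hyperplanes `ker l_C`, `C` a cycle; `ε C` is the chosen orientation
of `C`. -/
def M (ε : Finset G.Edge → G.Edge → ℤ) : Set (G.Edge → ℂ) :=
  {l | ∀ C, G.IsCycle C → l ∉ LinearMap.ker (G.linForm C (ε C))}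

open scoped Classical in
/-- The canonical basis vector `f_S` of `ℝ^𝒯`, for `S` a spanning tree. -/
noncomputable def treeVec (S : Finset G.Edge) : G.SpanningTree → ℝ :=
  fun T => if T.1 = S then 1 else 0

open scoped Classical in
/-- The endomorphism `Ω_σ`: `f_T ↦ f_T` if `σ ⊆ T`, and `f_T ↦ 0` otherwise. -/
noncomputable def OmegaPath (σ : Finset G.Edge) :
    (G.SpanningTree → ℝ) →ₗ[ℝ] (G.SpanningTree → ℝ) :=
  (Pi.basisFun ℝ G.SpanningTree).constr ℝ fun T => if σ ⊆ T.1 then G.treeVec T.1 else 0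

open scoped Classical in
/-- The endomorphism `Ω_C`: `f_T ↦ ∑_{e ∈ C} ε_C(e₀, e) α_e f_{T ∪ {e₀} \ {e}}` if there is `e₀ ∉ T`
with `C ⊆ T ∪ {e₀}`, and `f_T ↦ 0` otherwise. Such an `e₀` is unique (it is the only element of
`C` outside `T`), so the outer sum has at most one term;
`ε_C(e₀, e) = ε_C(e₀) ε_C(e)` compares the directions of `e₀` and `e` in `C`. -/
noncomputable def OmegaCycle (α : G.Edge → ℝ) (C : Finset G.Edge) (ε : G.Edge → ℤ) :
    (G.SpanningTree → ℝ) →ₗ[ℝ] (G.SpanningTree → ℝ) :=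
  (Pi.basisFun ℝ G.SpanningTree).constr ℝ fun T =>
    ∑ e₀ : G.Edge with e₀ ∉ T.1 ∧ C ⊆ insert e₀ T.1,
      ∑ e ∈ C, (((ε e₀ * ε e : ℤ) : ℝ) * α e) • G.treeVec ((insert e₀ T.1).erase e)

/-- The `𝒯 × 𝒯` matrix of an endomorphism `A` of `ℝ^𝒯` whose row of index `T` holds the coordinates
of `A f_T`. -/
noncomputable def rowMatrix (A : (G.SpanningTree → ℝ) →ₗ[ℝ] (G.SpanningTree → ℝ)) :
    Matrix G.SpanningTree G.SpanningTree ℂ :=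
  Matrix.of fun T T' => ((A (Pi.single T 1) T' : ℝ) : ℂ)

open scoped Classical in
/-- The matrix-valued differential form
`Ω = ∑_σ dl_σ Ω_σ + ∑_C (dl_C / l_C) Ω_C` at the point `λ = l`, a linear function of the
tangent vector. The sums run over the simple paths `σ` from `x₀` to `δ` and over the cycles `C`. -/
noncomputable def Omega (α : G.Edge → ℝ) (ε : Finset G.Edge → G.Edge → ℤ) (l : G.Edge → ℂ) :
    (G.Edge → ℂ) →ₗ[ℂ] Matrix G.SpanningTree G.SpanningTree ℂ :=
  ∑ σ : Finset G.Edge with G.IsSimplePath G.x₀ G.δ σ,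
      (G.linForm σ (G.pathSign G.x₀ G.δ σ)).smulRight (G.rowMatrix (G.OmegaPath σ)) +
    ∑ C : Finset G.Edge with G.IsCycle C,
      ((G.linForm C (ε C) l)⁻¹ • G.linForm C (ε C)).smulRight
        (G.rowMatrix (G.OmegaCycle α C (ε C)))

end PreGraph

/-- A graph with cemetery `δ` and base point `x₀` such that every vertex `x ≠ δ` is joined to `δ`,
and `x₀` to every other vertex `x ≠ δ`, by a directed simple path. -/
structure RootedGraph (V : Type*) extends PreGraph V where
  path_to_δ : ∀ x, x ≠ δ → ∃ σ, toPreGraph.IsDirectedPath x δ σ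
  path_from_x₀ : ∀ x, x ≠ δ → x ≠ x₀ → ∃ σ, toPreGraph.IsDirectedPath x₀ x σ

open MeasureTheory Filter Topology

namespace PreGraph

variable {V : Type*} (G : PreGraph V)

/-! ### Connectivity -/

/-! Differentiating under the integral sign gives `dI_T = -∑_a M_a dλ_a`, where `M_a` (`moment`) is
the integral for `T` with an extra factor `z_a`. The system comes from expressing these moments
through the integrals for neighbouring trees.

Fix `T`. A flow with prescribed divergence is determined by its values off `T`
(`IsSpanningTree.eq_of_eqOn_compl`), so each `z` in the affine space is the unit flow along the path
`σ ⊆ T` from `x₀` to `δ`, plus `z_{e₀}` times the normalized circulation `c` of the fundamental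
cycle of `e₀`, summed over `e₀ ∉ T` (`IsSpanningTree.eq_flow_add_sum`). Integration turns this into
`∑_a M_a dλ_a = dl_σ I_T + ∑_{e₀} ε_C(e₀) dl_C M_{e₀}`: the first term is the action of the `Ω_σ`.

For `M_{e₀}`, put `S = T ∪ {e₀}` and let `g` be `exp (-⟨λ, z⟩) ∏ z_e ^ α_e` divided by the `z_e`
with `e ∉ S`. Then `g` is the integrand of `M_{e₀}`, and `g / z_e`, for `e ∈ C`, is the integrand of
the tree `S \ {e}`. In the direction `c`, which vanishes off `C ⊆ S`, the derivative of `g` is `-(∑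
λ_e c_e) g + ∑_{e ∈ C} α_e c_e g / z_e`. The values `c_e = ±1` make all these trees induce the same
measure (`IsSpanningTree.exists_parametrization`), so Fubini along lines parallel to `c` yields
`ε_C(e₀) l_C M_{e₀} = ∑_{e ∈ C} α_e ε_C(e₀, e) I_{S \ {e}}`
(`IsSpanningTree.sum_cycleFlow_mul_integral`). Division by `l_C` gives the row of `Ω_C`.

The boundary terms vanish although nothing is assumed about the individual `α_e`: absolute
convergence for the exchanged trees says that `g / z_e` is integrable, and this suffices
(`integral_deriv_eq_zero_of_integrableOn_div`). -/

/-- The undirected graph whose edges are the elements of `S` with their direction forgotten. -/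
def undirected (S : Finset G.Edge) : SimpleGraph V where
  Adj x y := ∃ e ∈ S, G.Joins e x y
  symm := ⟨fun _ _ ⟨e, he, h⟩ => ⟨e, he, h.symm⟩⟩
  loopless := ⟨fun x ⟨e, _, h⟩ => G.no_loop x (by
    have h' : e.1 = (x, x) := h.elim id id
    exact h' ▸ e.2)⟩

variable {G}

lemma ends_ne (e : G.Edge) : e.1.1 ≠ e.1.2 := fun h =>
  G.no_loop e.1.1 (by
    have h' : e.1 = (e.1.1, e.1.1) := Prod.ext rfl h.symm
    exact h' ▸ e.2)

lemma joins_ends (e : G.Edge) : G.Joins e e.1.1 e.1.2 := Or.inl rfl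

lemma exists_isSimplePath_of_reachable {S : Finset G.Edge} {x y : V}
    (h : (G.undirected S).Reachable x y) : ∃ σ, G.IsSimplePath x y σ ∧ σ ⊆ S := by
  classical
  obtain ⟨p, hp⟩ := h.exists_isPath
  have hadj (j : Fin p.length) := p.adj_getVert_succ j.2
  choose e heS hej using hadj
  refine ⟨Finset.univ.image e, ⟨p.length, fun i => p.getVert i, e, ?_⟩, ?_⟩
  · refine ⟨?_, by simp, by simp, fun j => by simpa using hej j, ?_⟩
    · intro i j hij
      exact Fin.ext (hp.getVert_injOn (by simpa using i.is_le) (by simpa using j.is_le) hij)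
    · ext; simp
  · intro a ha
    obtain ⟨j, -, rfl⟩ := Finset.mem_image.1 ha
    exact heS j

lemma IsPathList.reachable {x y : V} {σ S : Finset G.Edge} {k : ℕ} {v : Fin (k + 1) → V}
    {e : Fin k → G.Edge} (h : G.IsPathList x y σ v e) (hS : σ ⊆ S) :
    (G.undirected S).Reachable x y := by
  have key : ∀ j, (G.undirected S).Reachable x (v j) := by
    intro j
    induction j using Fin.induction with
    | zero => rw [h.start]
    | succ i ih =>
      refine ih.trans (SimpleGraph.Adj.reachable ⟨e i, hS ?_, h.joins i⟩)
      rw [h.image_eq]; exact Finset.mem_image_of_mem _ (Finset.mem_univ _)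
  exact h.finish ▸ key (Fin.last k)

lemma isSpanningTree_iff {T : Finset G.Edge} : G.IsSpanningTree T ↔
    (∀ C, G.IsCycle C → ¬ C ⊆ T) ∧ ∀ x y : V, (G.undirected T).Reachable x y := by
  refine and_congr_right fun _ => ⟨fun h x y => ?_, fun h x y _ =>
    exists_isSimplePath_of_reachable (h x y)⟩
  by_cases hxy : x = y
  · rw [hxy]
  · obtain ⟨σ, ⟨k, v, e, hp⟩, hσ⟩ := h x y hxy
    exact hp.reachable hσ

/-- An edge used at steps `i` and `j` has the same ends at both, so distinctness of the vertices
forces `{i, i + 1} = {j, j + 1}`. -/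
lemma IsPathList.injective_edges {x y : V} {σ : Finset G.Edge} {k : ℕ} {v : Fin (k + 1) → V}
    {e : Fin k → G.Edge} (h : G.IsPathList x y σ v e) : Function.Injective e := by
  intro i j hij
  have hi := h.joins i
  have hj := h.joins j
  rw [hij] at hi
  unfold Joins at hi hj
  have hv : ∀ {p q}, v p = v q ↔ p = q := h.inj.eq_iff
  rcases hi with hi | hi <;> rcases hj with hj | hj <;> rw [hi, Prod.mk.injEq] at hj <;>
    simp only [hv, Fin.ext_iff, Fin.val_castSucc, Fin.val_succ] at hj <;> ext <;> omega

/-- An edge closes a simple path between its ends which avoids it to a simple cycle. -/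
lemma IsSimplePath.isCycle_insert {a : G.Edge} {σ : Finset G.Edge}
    (h : G.IsSimplePath a.1.2 a.1.1 σ) (ha : a ∉ σ) : G.IsCycle (insert a σ) := by
  obtain ⟨k, v, e, h⟩ := h
  have hinj := h.injective_edges
  refine ⟨k, v, Fin.snoc e a, h.inj, ?_, ?_, ?_⟩
  · refine Fin.snoc_injective_iff.2 ⟨hinj, ?_⟩
    rintro ⟨j, rfl⟩
    exact ha (by rw [h.image_eq]; exact Finset.mem_image_of_mem _ (Finset.mem_univ _))
  · intro j
    refine Fin.lastCases ?_ (fun i => ?_) j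
    · simp only [Fin.snoc_last, Fin.last_add_one, h.start, h.finish]
      exact joins_ends a
    · simpa using h.joins i
  · ext b
    simp only [h.image_eq, Finset.mem_insert, Finset.mem_image, Finset.mem_univ, true_and,
      Fin.exists_fin_succ', Fin.snoc_castSucc, Fin.snoc_last]
    rw [or_comm, eq_comm (a := b)]

/-- The ends of an edge of a spanning tree are separated by removing it. -/
lemma IsSpanningTree.not_reachable_erase {T : Finset G.Edge} (hT : G.IsSpanningTree T)
    {e : G.Edge} (he : e ∈ T) : ¬ (G.undirected (T.erase e)).Reachable e.1.1 e.1.2 := by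
  intro h
  obtain ⟨σ, hσ, hsub⟩ := exists_isSimplePath_of_reachable h.symm
  refine hT.1 _ (hσ.isCycle_insert fun h' => Finset.notMem_erase e T (hsub h')) ?_
  exact Finset.insert_subset he (hsub.trans (Finset.erase_subset _ _))

/-! ### Divergence -/

open scoped Classical in
/-- The divergence at `x` as a linear form. -/
noncomputable def divMap (G : PreGraph V) (x : V) : (G.Edge → ℝ) →ₗ[ℝ] ℝ :=
  ∑ e : G.Edge, ((if e.1.1 = x then (1 : ℝ) else 0) - if e.1.2 = x then 1 else 0) •
    LinearMap.proj e

lemma div_eq_divMap (θ : G.Edge → ℝ) (x : V) : G.div θ x = G.divMap x θ := by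
  classical
  simp only [div, divMap, Finset.sum_filter, LinearMap.coe_sum, Finset.sum_apply,
    LinearMap.smul_apply, LinearMap.proj_apply, smul_eq_mul, sub_mul, ite_mul, one_mul, zero_mul,
    Finset.sum_sub_distrib]

open scoped Classical in
lemma divMap_single (a : G.Edge) (x : V) : G.divMap x (Pi.single a 1) =
    (if a.1.1 = x then (1 : ℝ) else 0) - if a.1.2 = x then 1 else 0 := by
  simp [divMap, Pi.single_apply]

lemma sum_divMap [Fintype V] (θ : G.Edge → ℝ) : ∑ x, G.divMap x θ = 0 := by
  classical
  simp only [divMap, LinearMap.coe_sum, Finset.sum_apply, LinearMap.smul_apply,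
    LinearMap.proj_apply, smul_eq_mul]
  rw [Finset.sum_comm]
  simp [← Finset.sum_mul]

/-- The total divergence is always zero, so the equation at `δ`, which the affine space omits,
follows from the others. -/
lemma divMap_eq_zero_of_ne [Fintype V] {θ : G.Edge → ℝ} (h : ∀ x, x ≠ G.δ → G.divMap x θ = 0)
    (x : V) : G.divMap x θ = 0 := by
  classical
  by_cases hx : x = G.δ
  · have := sum_divMap θ
    rw [Finset.sum_eq_single G.δ (fun y _ hy => h y hy) (by simp)] at this
    rw [hx, this]
  · exact h x hx

/-- A circulation vanishes on an edge which is the only edge of its support between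
a connected component and its complement. -/
lemma eq_zero_of_not_reachable [Fintype V] {θ : G.Edge → ℝ} (h : ∀ x, G.divMap x θ = 0)
    {S : Finset G.Edge} {e : G.Edge} (hS : ∀ a, a ≠ e → a ∉ S → θ a = 0)
    (he : ¬ (G.undirected S).Reachable e.1.1 e.1.2) : θ e = 0 := by
  classical
  -- Sum the divergence over the component of the origin of `e`: an edge of `S` has both ends inside
  -- or both outside and cancels, which leaves only `θ e`.
  have hsum : ∑ x with (G.undirected S).Reachable e.1.1 x, G.divMap x θ = 0 :=
    Finset.sum_eq_zero fun x _ => h x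
  simp only [divMap, LinearMap.coe_sum, Finset.sum_apply, LinearMap.smul_apply,
    LinearMap.proj_apply, smul_eq_mul] at hsum
  rw [Finset.sum_comm] at hsum
  simp only [← Finset.sum_mul, Finset.sum_sub_distrib, Finset.sum_ite_eq, Finset.mem_filter,
    Finset.mem_univ, true_and] at hsum
  rw [Finset.sum_eq_single e] at hsum
  · simpa [he] using hsum
  · intro a _ ha
    by_cases haS : a ∈ S
    · have hadj : (G.undirected S).Adj a.1.1 a.1.2 := ⟨a, haS, joins_ends a⟩
      have : (G.undirected S).Reachable e.1.1 a.1.1 ↔ (G.undirected S).Reachable e.1.1 a.1.2 :=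
        ⟨fun h => h.trans hadj.reachable, fun h => h.trans hadj.symm.reachable⟩
      simp [this]
    · simp [hS a ha haS]
  · simp

/-- A circulation supported by a spanning tree vanishes. -/
lemma IsSpanningTree.eq_zero [Fintype V] {T : Finset G.Edge} (hT : G.IsSpanningTree T)
    {θ : G.Edge → ℝ} (h : ∀ x, G.divMap x θ = 0) (hS : ∀ a, a ∉ T → θ a = 0) : θ = 0 := by
  ext e
  by_cases he : e ∈ T
  · exact eq_zero_of_not_reachable h
      (fun a ha haT => hS a fun h' => haT (Finset.mem_erase.2 ⟨ha, h'⟩)) (hT.not_reachable_erase he)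
  · exact hS e he

/-- The uniqueness principle behind the comparisons below: paths, cycles and their signs in a tree
are identified by identifying their flows. -/
lemma IsSpanningTree.eq_of_eqOn_compl [Fintype V] {T : Finset G.Edge} (hT : G.IsSpanningTree T)
    {θ η : G.Edge → ℝ} (h : ∀ x, G.divMap x θ = G.divMap x η) (hS : ∀ a, a ∉ T → θ a = η a) :
    θ = η :=
  sub_eq_zero.1 <| hT.eq_zero (fun x => by rw [map_sub, h, sub_self])
    fun a ha => by rw [Pi.sub_apply, hS a ha, sub_self]

/-! ### Flows along paths and cycles -/

open scoped Classical in
/-- The sign with which the edge `a` is used to go from `x` to `y`. -/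
noncomputable def stepSign (a : G.Edge) (x y : V) : ℤ := if a.1 = (x, y) then 1 else -1

open scoped Classical in
lemma divMap_stepSign_smul {a : G.Edge} {x y : V} (h : G.Joins a x y) (u : V) :
    G.divMap u ((stepSign a x y : ℝ) • Pi.single a 1) =
      (if x = u then (1 : ℝ) else 0) - if y = u then 1 else 0 := by
  rw [map_smul, divMap_single]
  have hne := ends_ne a
  rcases h with h | h
  · simp [stepSign, h]
  · rw [h] at hne
    simp [stepSign, h, Ne.symm hne]

/-- The function which is equal to `ε` on `S` and vanishes elsewhere. -/
noncomputable def flow (S : Finset G.Edge) (ε : G.Edge → ℤ) (a : G.Edge) : ℝ :=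
  if a ∈ S then (ε a : ℝ) else 0

lemma sum_smul_single_eq_flow {ι : Type*} [Fintype ι] {e : ι → G.Edge}
    (he : Function.Injective e) {s : ι → ℤ} {S : Finset G.Edge} (hS : ∀ a, a ∈ S ↔ ∃ j, e j = a)
    {ε : G.Edge → ℤ} (hε : ∀ j, ε (e j) = s j) :
    ∑ j, (s j : ℝ) • (Pi.single (e j) 1 : G.Edge → ℝ) = flow S ε := by
  classical
  ext a
  simp only [Finset.sum_apply, Pi.smul_apply, Pi.single_apply, smul_eq_mul, mul_ite, mul_one,
    mul_zero, flow]
  split_ifs with ha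
  · obtain ⟨j, rfl⟩ := (hS a).1 ha
    rw [Finset.sum_eq_single j]
    · simp [hε]
    · intro i _ hi
      rw [if_neg fun h => hi (he h.symm)]
    · simp
  · exact Finset.sum_eq_zero fun j _ => if_neg fun h => ha ((hS a).2 ⟨j, h.symm⟩)

lemma IsCycleOrientation.divMap_flow {C : Finset G.Edge} {ε : G.Edge → ℤ}
    (h : G.IsCycleOrientation C ε) (x : V) : G.divMap x (flow C ε) = 0 := by
  classical
  obtain ⟨k, v, e, h, hε⟩ := h
  have hs : ∀ j, ε (e j) = stepSign (e j) (v j) (v (j + 1)) := fun j => by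
    rw [hε, stepSign]
  rw [← sum_smul_single_eq_flow h.inj_edges (by simp [h.image_eq]) hs, map_sum]
  simp only [divMap_stepSign_smul (h.joins _)]
  rw [Finset.sum_sub_distrib, sub_eq_zero]
  -- The sums over starting and ending vertices differ by the cyclic shift `j ↦ j + 1`.
  exact (Equiv.sum_comp (Equiv.addRight 1) fun j => if v j = x then (1 : ℝ) else 0).symm

lemma IsCycleOrientation.eq_or {C : Finset G.Edge} {ε : G.Edge → ℤ}
    (h : G.IsCycleOrientation C ε) {a : G.Edge} (ha : a ∈ C) : ε a = 1 ∨ ε a = -1 := by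
  obtain ⟨k, v, e, h, hε⟩ := h
  rw [h.image_eq] at ha
  obtain ⟨j, -, rfl⟩ := Finset.mem_image.1 ha
  rw [hε]
  split_ifs <;> simp

lemma IsCycle.exists_isCycleOrientation {C : Finset G.Edge} (h : G.IsCycle C) :
    ∃ ε, G.IsCycleOrientation C ε := by
  classical
  obtain ⟨k, v, e, h⟩ := h
  exact ⟨Function.extend e (fun j => stepSign (e j) (v j) (v (j + 1))) 0, k, v, e, h, fun j => by
    rw [h.inj_edges.extend_apply, stepSign]⟩

open scoped Classical in
lemma IsPathList.divMap_flow {x y : V} {σ : Finset G.Edge} {k : ℕ} {v : Fin (k + 1) → V}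
    {e : Fin k → G.Edge} (h : G.IsPathList x y σ v e) {ε : G.Edge → ℤ}
    (hε : ∀ j, ε (e j) = stepSign (e j) (v j.castSucc) (v j.succ)) (u : V) :
    G.divMap u (flow σ ε) = (if x = u then (1 : ℝ) else 0) - if y = u then 1 else 0 := by
  rw [← sum_smul_single_eq_flow h.injective_edges (by simp [h.image_eq]) hε, map_sum]
  simp only [divMap_stepSign_smul (h.joins _)]
  have h₁ := Fin.sum_univ_succ fun j => if v j = u then (1 : ℝ) else 0
  have h₂ := Fin.sum_univ_castSucc fun j => if v j = u then (1 : ℝ) else 0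
  rw [h.start] at h₁
  rw [h.finish] at h₂
  rw [Finset.sum_sub_distrib]
  linarith

lemma mem_iff_flow_ne_zero {S : Finset G.Edge} {ε : G.Edge → ℤ}
    (h : ∀ a ∈ S, ε a = 1 ∨ ε a = -1) (a : G.Edge) : a ∈ S ↔ flow S ε a ≠ 0 := by
  unfold flow
  split_ifs with ha
  · rcases h a ha with h | h <;> simp [h, ha]
  · simp [ha]

lemma pathSign_eq_or (x y : V) (σ : Finset G.Edge) (a : G.Edge) :
    G.pathSign x y σ a = 1 ∨ G.pathSign x y σ a = -1 := by
  unfold pathSign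
  split_ifs <;> simp

open scoped Classical in
-- `pathSign` quantifies over all listings of `σ`, while the divergence is computed from one
-- listing. The tree serves to compare them: two listings give flows with the same divergence and
-- zero off `T`, hence the same signs.
lemma IsSpanningTree.divMap_flow_pathSign [Fintype V] {T : Finset G.Edge} (hT : G.IsSpanningTree T)
    {x y : V} {σ : Finset G.Edge} (hσ : G.IsSimplePath x y σ) (hσT : σ ⊆ T) (u : V) :
    G.divMap u (flow σ (G.pathSign x y σ)) =
      (if x = u then (1 : ℝ) else 0) - if y = u then 1 else 0 := by
  obtain ⟨k, v, e, h⟩ := hσ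
  have hext : ∀ j, Function.extend e (fun j => stepSign (e j) (v j.castSucc) (v j.succ)) 0 (e j) =
      stepSign (e j) (v j.castSucc) (v j.succ) := fun j => h.injective_edges.extend_apply _ _ j
  refine h.divMap_flow (fun j => ?_) u
  have hmem : e j ∈ σ := by rw [h.image_eq]; exact Finset.mem_image_of_mem _ (Finset.mem_univ _)
  by_cases hj : (e j).1 = (v j.castSucc, v j.succ)
  · rw [stepSign, if_pos hj, pathSign, if_pos ⟨k, v, e, h, j, rfl, hj⟩]
  · rw [stepSign, if_neg hj, pathSign, if_neg]
    rintro ⟨k', v', e', h', i, hi, hi'⟩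
    have hext' : ∀ j, Function.extend e' (fun j => stepSign (e' j) (v' j.castSucc) (v' j.succ)) 0
        (e' j) = stepSign (e' j) (v' j.castSucc) (v' j.succ) :=
      fun j => h'.injective_edges.extend_apply _ _ j
    have heq := congrFun (hT.eq_of_eqOn_compl
      (fun w => (h.divMap_flow hext w).trans (h'.divMap_flow hext' w).symm) fun a ha => by
        rw [flow, flow, if_neg fun h' => ha (hσT h'), if_neg fun h' => ha (hσT h')]) (e j)
    rw [flow, flow, if_pos hmem, if_pos hmem, hext, ← hi, hext', hi, stepSign, stepSign,
      if_neg hj, if_pos hi'] at heq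
    norm_num at heq

lemma IsSpanningTree.path_unique [Fintype V] {T : Finset G.Edge} (hT : G.IsSpanningTree T)
    {x y : V} {σ τ : Finset G.Edge} (hσ : G.IsSimplePath x y σ) (hσT : σ ⊆ T)
    (hτ : G.IsSimplePath x y τ) (hτT : τ ⊆ T) : σ = τ := by
  have heq := hT.eq_of_eqOn_compl (fun w => (hT.divMap_flow_pathSign hσ hσT w).trans
      (hT.divMap_flow_pathSign hτ hτT w).symm) fun a ha => by
        rw [flow, flow, if_neg fun h' => ha (hσT h'), if_neg fun h' => ha (hτT h')]
  ext a
  rw [mem_iff_flow_ne_zero (fun a _ => pathSign_eq_or x y σ a),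
    mem_iff_flow_ne_zero (fun a _ => pathSign_eq_or x y τ a), heq]

/-! ### Fundamental cycles -/

lemma IsSpanningTree.mem_of_subset_insert {T C : Finset G.Edge} (hT : G.IsSpanningTree T)
    {e₀ : G.Edge} (hC : G.IsCycle C) (hCT : C ⊆ insert e₀ T) : e₀ ∈ C := by
  by_contra h
  exact hT.1 C hC ((Finset.subset_insert_iff_of_notMem h).1 hCT)

lemma IsSpanningTree.exists_isCycle {T : Finset G.Edge} (hT : G.IsSpanningTree T)
    {e₀ : G.Edge} (he₀ : e₀ ∉ T) : ∃ C, G.IsCycle C ∧ C ⊆ insert e₀ T := by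
  obtain ⟨σ, hσ, hσT⟩ := hT.2 e₀.1.2 e₀.1.1 (ends_ne e₀).symm
  exact ⟨_, hσ.isCycle_insert fun h => he₀ (hσT h), Finset.insert_subset_insert _ hσT⟩

lemma IsCycleOrientation.mul_self {C : Finset G.Edge} {ε : G.Edge → ℤ}
    (h : G.IsCycleOrientation C ε) {a : G.Edge} (ha : a ∈ C) : (ε a : ℝ) * ε a = 1 := by
  rcases h.eq_or ha with h | h <;> simp [h]

/-- The circulation along an oriented cycle, normalized to be `1` at the edge `e₀`. -/
noncomputable def cycleFlow (C : Finset G.Edge) (ε : G.Edge → ℤ) (e₀ : G.Edge) : G.Edge → ℝ :=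
  (ε e₀ : ℝ) • flow C ε

lemma IsCycleOrientation.divMap_cycleFlow {C : Finset G.Edge} {ε : G.Edge → ℤ}
    (h : G.IsCycleOrientation C ε) (e₀ : G.Edge) (x : V) : G.divMap x (cycleFlow C ε e₀) = 0 := by
  rw [cycleFlow, map_smul, h.divMap_flow, smul_zero]

lemma cycleFlow_apply_of_mem {C : Finset G.Edge} {ε : G.Edge → ℤ} {e₀ a : G.Edge} (ha : a ∈ C) :
    cycleFlow C ε e₀ a = ε e₀ * ε a := by
  simp [cycleFlow, flow, ha]

lemma cycleFlow_apply_of_notMem {C : Finset G.Edge} {ε : G.Edge → ℤ} {e₀ a : G.Edge}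
    (ha : a ∉ C) : cycleFlow C ε e₀ a = 0 := by
  simp [cycleFlow, flow, ha]

lemma IsCycleOrientation.cycleFlow_self {C : Finset G.Edge} {ε : G.Edge → ℤ}
    (h : G.IsCycleOrientation C ε) {e₀ : G.Edge} (he₀ : e₀ ∈ C) : cycleFlow C ε e₀ e₀ = 1 := by
  rw [cycleFlow_apply_of_mem he₀, h.mul_self he₀]

lemma IsCycleOrientation.cycleFlow_eq_or {C : Finset G.Edge} {ε : G.Edge → ℤ}
    (h : G.IsCycleOrientation C ε) {e₀ a : G.Edge} (he₀ : e₀ ∈ C) (ha : a ∈ C) :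
    cycleFlow C ε e₀ a = 1 ∨ cycleFlow C ε e₀ a = -1 := by
  rw [cycleFlow_apply_of_mem ha]
  rcases h.eq_or he₀ with h₁ | h₁ <;> rcases h.eq_or ha with h₂ | h₂ <;> simp [h₁, h₂]

lemma IsCycleOrientation.mem_iff_cycleFlow {C : Finset G.Edge} {ε : G.Edge → ℤ}
    (h : G.IsCycleOrientation C ε) {e₀ : G.Edge} (he₀ : e₀ ∈ C) (a : G.Edge) :
    a ∈ C ↔ cycleFlow C ε e₀ a ≠ 0 := by
  refine ⟨fun ha => ?_, fun ha => by_contra fun h' => ha (cycleFlow_apply_of_notMem h')⟩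
  rcases h.cycleFlow_eq_or he₀ ha with h | h <;> simp [h]

/-- Both circulations, normalized to be `1` at `e₀`, agree off `T`, hence everywhere; the cycles are
their supports. -/
lemma IsSpanningTree.cycle_unique [Fintype V] {T : Finset G.Edge} (hT : G.IsSpanningTree T)
    {e₀ : G.Edge} {C D : Finset G.Edge} (hC : G.IsCycle C)
    (hCT : C ⊆ insert e₀ T) (hD : G.IsCycle D) (hDT : D ⊆ insert e₀ T) : C = D := by
  obtain ⟨ε, hε⟩ := hC.exists_isCycleOrientation
  obtain ⟨η, hη⟩ := hD.exists_isCycleOrientation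
  have hC₀ := hT.mem_of_subset_insert hC hCT
  have hD₀ := hT.mem_of_subset_insert hD hDT
  have heq : cycleFlow C ε e₀ = cycleFlow D η e₀ := by
    refine hT.eq_of_eqOn_compl (fun x => by rw [hε.divMap_cycleFlow, hη.divMap_cycleFlow])
      fun a ha => ?_
    by_cases ha₀ : a = e₀
    · rw [ha₀, hε.cycleFlow_self hC₀, hη.cycleFlow_self hD₀]
    · have ha' : a ∉ insert e₀ T := by simp [ha, ha₀]
      rw [cycleFlow_apply_of_notMem fun h => ha' (hCT h),
        cycleFlow_apply_of_notMem fun h => ha' (hDT h)]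
  ext a
  rw [hε.mem_iff_cycleFlow hC₀, hη.mem_iff_cycleFlow hD₀, heq]

/-- Exchanging an edge of the fundamental cycle of `e₀` with `e₀` gives a spanning tree. -/
lemma IsSpanningTree.exchange [Fintype V] {T : Finset G.Edge} (hT : G.IsSpanningTree T)
    {e₀ e : G.Edge} {C : Finset G.Edge} (hC : G.IsCycle C)
    (hCT : C ⊆ insert e₀ T) (he : e ∈ C) : G.IsSpanningTree ((insert e₀ T).erase e) := by
  rw [isSpanningTree_iff]
  constructor
  · intro D hD hDT
    rw [← hT.cycle_unique hC hCT hD (hDT.trans (Finset.erase_subset _ _))] at hDT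
    exact Finset.notMem_erase e _ (hDT he)
  · obtain ⟨ε, hε⟩ := hC.exists_isCycleOrientation
    -- Otherwise `e` would be the only edge of `C` leaving a component, and the circulation along
    -- `C` would vanish on it.
    have hends : (G.undirected ((insert e₀ T).erase e)).Reachable e.1.1 e.1.2 := by
      by_contra hcon
      have hzero := eq_zero_of_not_reachable (θ := flow C ε) hε.divMap_flow
        (fun a ha ha' => if_neg fun haC => ha' (Finset.mem_erase.2 ⟨ha, hCT haC⟩)) hcon
      exact (mem_iff_flow_ne_zero (fun a ha => hε.eq_or ha) e).1 he hzero
    have hadj : ∀ x y, (G.undirected T).Adj x y →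
        (G.undirected ((insert e₀ T).erase e)).Reachable x y := by
      rintro x y ⟨a, ha, hj⟩
      by_cases hae : a = e
      · subst hae
        rcases hj with hj | hj <;> rw [hj] at hends
        exacts [hends, hends.symm]
      · exact SimpleGraph.Adj.reachable
          ⟨a, Finset.mem_erase.2 ⟨hae, Finset.mem_insert_of_mem ha⟩, hj⟩
    intro x y
    obtain ⟨p⟩ := (isSpanningTree_iff.1 hT).2 x y
    induction p with
    | nil => rfl
    | cons h _ ih => exact (hadj _ _ h).trans ih

/-! ### The affine space in the coordinates given by a spanning tree -/

open scoped Classical in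
lemma mem_affineSpace_iff {z : G.Edge → ℝ} : z ∈ G.affineSpace ↔
    ∀ x, x ≠ G.δ → G.divMap x z = if x = G.x₀ then 1 else 0 := by
  simp only [affineSpace, Set.mem_ofPred_eq, div_eq_divMap]

lemma divMap_eq_of_mem_affineSpace [Fintype V] {z w : G.Edge → ℝ} (hz : z ∈ G.affineSpace)
    (hw : w ∈ G.affineSpace) (x : V) : G.divMap x z = G.divMap x w := by
  classical
  rw [← sub_eq_zero, ← map_sub]
  refine divMap_eq_zero_of_ne (fun x hx => ?_) x
  rw [map_sub, mem_affineSpace_iff.1 hz x hx, mem_affineSpace_iff.1 hw x hx, sub_self]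

lemma add_mem_affineSpace {z c : G.Edge → ℝ} (hz : z ∈ G.affineSpace)
    (hc : ∀ x, G.divMap x c = 0) : z + c ∈ G.affineSpace := by
  rw [mem_affineSpace_iff] at hz ⊢
  intro x hx
  rw [map_add, hc, add_zero, hz x hx]

lemma IsSpanningTree.flow_pathSign_mem [Fintype V] {T : Finset G.Edge} (hT : G.IsSpanningTree T)
    {σ : Finset G.Edge} (hσ : G.IsSimplePath G.x₀ G.δ σ) (hσT : σ ⊆ T) :
    flow σ (G.pathSign G.x₀ G.δ σ) ∈ G.affineSpace := by
  classical
  rw [mem_affineSpace_iff]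
  intro x hx
  rw [hT.divMap_flow_pathSign hσ hσT, if_neg (Ne.symm hx), sub_zero]
  simp only [eq_comm]

/-- For a spanning tree `T`, a point of the affine space is the sum of the flow along the path
in `T` from `x₀` to `δ` and of the circulations along the fundamental cycles. -/
lemma IsSpanningTree.eq_flow_add_sum [Fintype V] {T : Finset G.Edge} (hT : G.IsSpanningTree T)
    {b : G.Edge → ℝ} (hb : b ∈ G.affineSpace) (hbT : ∀ a, a ∉ T → b a = 0)
    {c : G.Edge → G.Edge → ℝ} (hc : ∀ e₀, e₀ ∉ T → ∀ x, G.divMap x (c e₀) = 0)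
    (hc₀ : ∀ e₀, e₀ ∉ T → c e₀ e₀ = 1)
    (hcT : ∀ e₀, e₀ ∉ T → ∀ a, a ∉ insert e₀ T → c e₀ a = 0)
    {z : G.Edge → ℝ} (hz : z ∈ G.affineSpace) :
    z = b + ∑ e₀ ∈ Tᶜ, z e₀ • c e₀ := by
  refine hT.eq_of_eqOn_compl (divMap_eq_of_mem_affineSpace hz
    (add_mem_affineSpace hb fun x => ?_)) fun a ha => ?_
  · rw [map_sum]
    refine Finset.sum_eq_zero fun e₀ he₀ => ?_
    rw [map_smul, hc e₀ (Finset.mem_compl.1 he₀), smul_zero]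
  · simp only [Pi.add_apply, hbT a ha, Finset.sum_apply, Pi.smul_apply, smul_eq_mul, zero_add]
    rw [Finset.sum_eq_single a]
    · rw [hc₀ a ha, mul_one]
    · intro e₀ he₀ hne
      rw [hcT e₀ (Finset.mem_compl.1 he₀) a (by simp [ha, hne.symm]), mul_zero]
    · intro h
      exact absurd (Finset.mem_compl.2 ha) h

end PreGraph

/-! ### Integration by parts on a polyhedral interval -/

/-- For the cutoff `ρ(y) = smoothTransition (y - 1)`, this bounds the derivative of `t ↦ ρ(n p(t))`
by `B |p'| / p` where `p > 0`, uniformly in `n`. It holds because `ρ` is constant off `[1, 2]`. -/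
lemma exists_bound_mul_deriv_smoothTransition :
    ∃ B : ℝ, ∀ x : ℝ, |x * deriv (fun y => Real.smoothTransition (y - 1)) x| ≤ B := by
  have hsm : ContDiff ℝ 1 fun y : ℝ => Real.smoothTransition (y - 1) :=
    Real.smoothTransition.contDiff.comp (contDiff_id.sub contDiff_const)
  have hcont : Continuous fun x : ℝ => x * deriv (fun y => Real.smoothTransition (y - 1)) x :=
    continuous_id.mul (hsm.continuous_deriv le_rfl)
  obtain ⟨B, hB⟩ := (isCompact_Icc (a := (1 : ℝ)) (b := 2)).exists_bound_of_continuousOn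
    hcont.continuousOn
  have hB₀ : 0 ≤ B := (norm_nonneg _).trans (hB 1 (by norm_num))
  refine ⟨B, fun x => ?_⟩
  by_cases hx : x ∈ Set.Icc (1 : ℝ) 2
  · exact hB x hx
  · have h0 : deriv (fun y => Real.smoothTransition (y - 1)) x = 0 := by
      rw [Set.mem_Icc, not_and_or, not_le, not_le] at hx
      rcases hx with hx | hx
      · have : (fun y : ℝ => Real.smoothTransition (y - 1)) =ᶠ[𝓝 x] fun _ => 0 := by
          filter_upwards [Iio_mem_nhds hx] with y hy
          exact Real.smoothTransition.zero_of_nonpos (by linarith [Set.mem_Iio.1 hy])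
        rw [this.deriv_eq, deriv_const]
      · have : (fun y : ℝ => Real.smoothTransition (y - 1)) =ᶠ[𝓝 x] fun _ => 1 := by
          filter_upwards [Ioi_mem_nhds hx] with y hy
          exact Real.smoothTransition.one_of_one_le (by linarith [Set.mem_Ioi.1 hy])
        rw [this.deriv_eq, deriv_const]
    rw [h0, mul_zero, abs_zero]
    exact hB₀

/-- The integral of a derivative over a polyhedral interval vanishes if the function remains
integrable after division by each of the affine functions which cut out the interval. -/
theorem integral_deriv_eq_zero_of_integrableOn_div {ι : Type*} [Fintype ι] (a c : ι → ℝ)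
    {J : Set ℝ} (hJ : J = {t | ∀ i, 0 < a i + t * c i}) {f f' : ℝ → ℂ}
    (hderiv : ∀ t ∈ J, HasDerivAt f (f' t) t) (hf : IntegrableOn f J) (hf' : IntegrableOn f' J)
    (hdiv : ∀ i, c i ≠ 0 → IntegrableOn (fun t => f t / ((a i + t * c i : ℝ) : ℂ)) J) :
    ∫ t in J, f' t = 0 := by
  classical
  set ρ : ℝ → ℝ := fun y => Real.smoothTransition (y - 1) with hρ
  have hsm : ContDiff ℝ 1 ρ :=
    Real.smoothTransition.contDiff.comp (contDiff_id.sub contDiff_const)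
  have hρd : ∀ x, HasDerivAt ρ (deriv ρ x) x := fun x =>
    (hsm.differentiable one_ne_zero x).hasDerivAt
  have hρ0 : ∀ x, x < 1 → ρ x = 0 := fun x hx =>
    Real.smoothTransition.zero_of_nonpos (by linarith)
  have hρ1 : ∀ x, 2 < x → ρ x = 1 := fun x hx =>
    Real.smoothTransition.one_of_one_le (by linarith)
  have hρ1' : ∀ x, 2 < x → deriv ρ x = 0 := fun x hx => by
    have : ρ =ᶠ[𝓝 x] fun _ => 1 := by
      filter_upwards [Ioi_mem_nhds hx] with y hy using hρ1 y hy
    rw [this.deriv_eq, deriv_const]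
  have hρabs : ∀ x, |ρ x| ≤ 1 := fun x => by
    rw [abs_of_nonneg (Real.smoothTransition.nonneg _)]
    exact Real.smoothTransition.le_one _
  obtain ⟨B, hB⟩ := exists_bound_mul_deriv_smoothTransition
  let p : ι → ℝ → ℝ := fun i t => a i + t * c i
  have hpc : ∀ i, Continuous (p i) := fun i => by fun_prop
  have hpd : ∀ i t, HasDerivAt (p i) (c i) t := fun i t => by
    have h := ((hasDerivAt_id t).mul_const (c i)).const_add (a i)
    rwa [one_mul] at h
  have hJo : IsOpen J := by
    rw [hJ, show {t : ℝ | ∀ i, 0 < a i + t * c i} = ⋂ i, {t | 0 < p i t} by ext; simp [p]]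
    exact isOpen_iInter_of_finite fun i => isOpen_lt continuous_const (hpc i)
  have hpJ : ∀ t ∈ J, ∀ i, 0 < p i t := fun t ht => by rw [hJ] at ht; exact ht
  -- The cutoff `χ n` vanishes near every zero of a `p i` and tends to `1` on `J`.
  let χ : ℕ → ℝ → ℝ := fun n t => ∏ i, ρ (n * p i t)
  let χ' : ℕ → ℝ → ℝ := fun n t =>
    ∑ i, (∏ j ∈ Finset.univ.erase i, ρ (n * p j t)) * (deriv ρ (n * p i t) * (n * c i))
  have hχd : ∀ n t, HasDerivAt (χ n) (χ' n t) t := fun n t => by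
    have := HasDerivAt.fun_finsetProd (u := Finset.univ) (f := fun i t => ρ (n * p i t))
      (f' := fun i => deriv ρ (n * p i t) * (n * c i)) (x := t)
      fun i _ => HasDerivAt.comp (h₂ := ρ) t (hρd (n * p i t)) ((hpd i t).const_mul (n : ℝ))
    simpa only [smul_eq_mul] using this
  have hχc : ∀ n, Continuous (χ n) := fun n =>
    continuous_finsetProd _ fun i _ => hsm.continuous.comp (continuous_const.mul (hpc i))
  have hχ'c : ∀ n, Continuous (χ' n) := fun n =>
    continuous_finsetSum _ fun i _ => Continuous.mul
      (continuous_finsetProd _ fun j _ => hsm.continuous.comp (continuous_const.mul (hpc j)))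
      (((hsm.continuous_deriv le_rfl).comp (continuous_const.mul (hpc i))).mul continuous_const)
  have hprod : ∀ (s : Finset ι) n t, |∏ i ∈ s, ρ (n * p i t)| ≤ 1 := fun s n t => by
    rw [Finset.abs_prod]
    exact Finset.prod_le_one (fun _ _ => abs_nonneg _) fun _ _ => hρabs _
  -- A majorant of `χ' n * f` independent of `n`; its integrability is exactly what `hdiv` provides.
  let bd : ℝ → ℝ := fun t => ∑ i, |c i| * B * ‖f t / ((p i t : ℝ) : ℂ)‖
  have hbd : IntegrableOn bd J := by
    refine integrable_finsetSum _ fun i _ => ?_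
    by_cases hi : c i = 0
    · simp [hi]
    · exact (hdiv i hi).norm.const_mul _
  have hχ'le : ∀ n, ∀ t ∈ J, ‖(χ' n t : ℂ) * f t‖ ≤ bd t := fun n t ht => by
    rw [norm_mul, Complex.norm_real, Real.norm_eq_abs]
    calc |χ' n t| * ‖f t‖ ≤ (∑ i, |c i| * B / p i t) * ‖f t‖ := by
          refine mul_le_mul_of_nonneg_right ?_ (norm_nonneg _)
          refine (Finset.abs_sum_le_sum_abs _ _).trans (Finset.sum_le_sum fun i _ => ?_)
          have hp := hpJ t ht i
          rw [abs_mul, le_div_iff₀ hp]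
          calc _ ≤ 1 * |deriv ρ (n * p i t) * (n * c i)| * p i t := by
                gcongr; exact hprod _ _ _
            _ = |c i| * |(n * p i t) * deriv ρ (n * p i t)| := by
                nth_rewrite 2 [← abs_of_pos hp]
                rw [one_mul, ← abs_mul, ← abs_mul]; congr 1; ring
            _ ≤ |c i| * B := by gcongr; exact hB _
      _ = bd t := by
          simp only [bd, Finset.sum_mul, norm_div, Complex.norm_real, Real.norm_eq_abs]
          refine Finset.sum_congr rfl fun i _ => ?_
          rw [abs_of_pos (hpJ t ht i)]; ring
  have hχmeas : ∀ n, AEStronglyMeasurable (fun t => (χ n t : ℂ)) (volume.restrict J) := fun n =>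
    (Complex.continuous_ofReal.comp (hχc n)).aestronglyMeasurable
  have hχnorm : ∀ n t, ‖(χ n t : ℂ)‖ ≤ 1 := fun n t => by
    rw [Complex.norm_real]; exact hprod _ n t
  have hint1 : ∀ n, IntegrableOn (fun t => (χ' n t : ℂ) * f t) J := fun n =>
    Integrable.mono' hbd ((Complex.continuous_ofReal.comp (hχ'c n)).aestronglyMeasurable.mul hf.1)
      ((ae_restrict_iff' hJo.measurableSet).2 (ae_of_all _ (hχ'le n)))
  have hint2 : ∀ n, IntegrableOn (fun t => (χ n t : ℂ) * f' t) J := fun n =>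
    hf'.bdd_mul (hχmeas n) (ae_of_all _ (hχnorm n))
  have hint0 : ∀ n, IntegrableOn (fun t => (χ n t : ℂ) * f t) J := fun n =>
    hf.bdd_mul (hχmeas n) (ae_of_all _ (hχnorm n))
  have hzero : ∀ n, ∫ t in J, ((χ' n t : ℂ) * f t + (χ n t : ℂ) * f' t) = 0 := fun n => by
    rw [← integral_indicator hJo.measurableSet]
    refine integral_eq_zero_of_hasDerivAt_of_integrable
      (f := J.indicator fun t => (χ n t : ℂ) * f t) (fun t => ?_)
      (((hint1 n).add (hint2 n)).integrable_indicator hJo.measurableSet)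
      ((hint0 n).integrable_indicator hJo.measurableSet)
    by_cases ht : t ∈ J
    · rw [Set.indicator_of_mem ht]
      refine ((hχd n t).ofReal_comp.mul (hderiv t ht)).congr_of_eventuallyEq ?_
      filter_upwards [hJo.mem_nhds ht] with s hs
      rw [Set.indicator_of_mem hs]
      rfl
    · rw [Set.indicator_of_notMem ht]
      have ht' := ht
      rw [hJ, Set.mem_ofPred_eq, not_forall] at ht'
      obtain ⟨i, hi⟩ := ht'
      -- Off `J` some factor of `χ n` is zero in a whole neighbourhood, so the extension of `χ n *
      -- f` by zero is differentiable on all of `ℝ`, also at the ends of `J`.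
      have hlt : (n : ℝ) * p i t < 1 :=
        (mul_nonpos_of_nonneg_of_nonpos n.cast_nonneg (not_lt.1 hi)).trans_lt one_pos
      refine (hasDerivAt_const t (0 : ℂ)).congr_of_eventuallyEq ?_
      filter_upwards [(continuous_const.mul (hpc i)).continuousAt.eventually_lt
        continuousAt_const hlt] with s hs
      refine Set.indicator_apply_eq_zero.2 fun _ => ?_
      rw [show χ n s = 0 from Finset.prod_eq_zero (Finset.mem_univ i) (hρ0 _ hs)]
      simp
  have hlim : Tendsto (fun n => ∫ t in J, ((χ' n t : ℂ) * f t + (χ n t : ℂ) * f' t)) atTop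
      (𝓝 (∫ t in J, f' t)) := by
    refine tendsto_integral_of_dominated_convergence (fun t => bd t + ‖f' t‖)
      (fun n => ((hint1 n).add (hint2 n)).1) (hbd.add hf'.norm) (fun n => ?_) ?_
    · refine (ae_restrict_iff' hJo.measurableSet).2 (ae_of_all _ fun t ht => ?_)
      refine (norm_add_le _ _).trans (add_le_add (hχ'le n t ht) ?_)
      rw [norm_mul]
      exact mul_le_of_le_one_left (norm_nonneg _) (hχnorm n t)
    · refine (ae_restrict_iff' hJo.measurableSet).2 (ae_of_all _ fun t ht => ?_)
      -- At a fixed point of `J` all the arguments `n * p i t` eventually exceed `2`, where `ρ = 1`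
      -- and `ρ' = 0`.
      have hev : ∀ᶠ n : ℕ in atTop, ∀ i, 2 < (n : ℝ) * p i t := eventually_all.2 fun i =>
        (tendsto_natCast_atTop_atTop.atTop_mul_const (hpJ t ht i)).eventually_gt_atTop 2
      refine tendsto_const_nhds.congr' ?_
      filter_upwards [hev] with n hn
      have h1 : χ n t = 1 := Finset.prod_eq_one fun i _ => hρ1 _ (hn i)
      have h2 : χ' n t = 0 := Finset.sum_eq_zero fun i _ => by
        rw [hρ1' _ (hn i), zero_mul, mul_zero]
      simp [h1, h2]
  simp only [hzero] at hlim
  exact tendsto_nhds_unique hlim tendsto_const_nhds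

/-! ### Volume in the coordinates of the affine space -/

lemma measurePreserving_pi_of_option {κ ι : Type*} [Fintype κ] [Fintype ι] {j : κ → ι} {i₀ : ι}
    (hj : Function.Bijective fun o : Option κ => o.elim i₀ j) {Q : (κ → ℝ) × ℝ → ι → ℝ}
    (hQ₀ : ∀ x, Q x i₀ = x.2) (hQ : ∀ x k, Q x (j k) = x.1 k) :
    MeasurePreserving Q volume volume := by
  have hsurj : ∀ i, i = i₀ ∨ ∃ k, i = j k := fun i => by
    obtain ⟨o, rfl⟩ := hj.2 i
    cases o
    exacts [Or.inl rfl, Or.inr ⟨_, rfl⟩]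
  have hmeas : Measurable Q := measurable_pi_lambda _ fun i => by
    rcases hsurj i with rfl | ⟨k, rfl⟩
    · simpa only [hQ₀] using measurable_snd
    · simp only [hQ]
      exact (measurable_pi_apply k).comp measurable_fst
  refine ⟨hmeas, (Measure.pi_eq fun s hs => ?_).symm⟩
  have hpre : Q ⁻¹' Set.univ.pi s = (Set.univ.pi fun k => s (j k)) ×ˢ s i₀ := by
    ext x
    simp only [Set.mem_preimage, Set.mem_univ_pi, Set.mem_prod]
    refine ⟨fun h => ⟨fun k => hQ x k ▸ h (j k), hQ₀ x ▸ h i₀⟩, fun h i => ?_⟩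
    rcases hsurj i with rfl | ⟨k, rfl⟩
    · rw [hQ₀]; exact h.2
    · rw [hQ]; exact h.1 k
  rw [Measure.map_apply hmeas (MeasurableSet.univ_pi hs), hpre, Measure.volume_eq_prod,
    Measure.prod_prod, volume_pi_pi, ← (Equiv.ofBijective _ hj).prod_comp, Fintype.prod_option,
    mul_comm]
  rfl

/-- For fixed `x.1` the remaining coordinate undergoes a translation or a reflection, which preserve
Lebesgue measure. The condition `s = ±1` is where the unimodularity of circulations enters. -/
lemma measurePreserving_pi_of_option_shear {κ ι : Type*} [Fintype κ] [Fintype ι] {j : κ → ι}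
    {i₀ : ι} (hj : Function.Bijective fun o : Option κ => o.elim i₀ j) {h : (κ → ℝ) → ℝ}
    (hh : Measurable h) {s : ℝ} (hs : s = 1 ∨ s = -1) {Q : (κ → ℝ) × ℝ → ι → ℝ}
    (hQ₀ : ∀ x, Q x i₀ = h x.1 + x.2 * s) (hQ : ∀ x k, Q x (j k) = x.1 k) :
    MeasurePreserving Q volume volume := by
  set φ := Equiv.ofBijective _ hj
  have hφ₀ : φ.symm i₀ = none := φ.symm_apply_eq.2 rfl
  have hφj : ∀ k, φ.symm (j k) = some k := fun k => φ.symm_apply_eq.2 rfl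
  have hΦ : MeasurePreserving (fun (x : (κ → ℝ) × ℝ) i => (φ.symm i).elim x.2 x.1) volume volume :=
    measurePreserving_pi_of_option hj (fun x => by simp [hφ₀]) fun x k => by simp [hφj]
  have hR : MeasurePreserving (fun x : (κ → ℝ) × ℝ => (x.1, h x.1 + x.2 * s)) volume volume := by
    refine (MeasurePreserving.id volume).skew_product
      (g := fun w t => h w + t * s) (by fun_prop) (ae_of_all _ fun w => ?_)
    rcases hs with rfl | rfl
    · simpa using (measurePreserving_add_left volume (h w)).map_eq
    · simpa [← sub_eq_add_neg] using (Measure.measurePreserving_sub_left volume (h w)).map_eq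
  convert hΦ.comp hR using 1
  funext x i
  obtain ⟨o, rfl⟩ := hj.2 i
  cases o <;> simp [hφ₀, hφj, hQ₀, hQ]

namespace PreGraph

variable {V : Type*} {G : PreGraph V}

/-- The coordinates `(z_e)_{e ∉ T}` of the affine space, for a spanning tree `T`. -/
lemma IsSpanningTree.exists_measurableEquiv [Fintype V] {T : Finset G.Edge}
    (hT : G.IsSpanningTree T) : ∃ F : G.affineSpace ≃ᵐ ({e : G.Edge // e ∉ T} → ℝ),
      ∀ z e, F z e = z.1 e.1 := by
  classical
  obtain ⟨σ, hσ, hσT⟩ := hT.2 _ _ G.x₀_ne_δ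
  have hex : ∀ i : {e : G.Edge // e ∉ T}, ∃ c : G.Edge → ℝ, (∀ x, G.divMap x c = 0) ∧
      c i = 1 ∧ ∀ a, a ∉ insert i.1 T → c a = 0 := fun i => by
    obtain ⟨C, hC, hCT⟩ := hT.exists_isCycle i.2
    obtain ⟨ε, hε⟩ := hC.exists_isCycleOrientation
    exact ⟨cycleFlow C ε i.1, hε.divMap_cycleFlow i.1,
      hε.cycleFlow_self (hT.mem_of_subset_insert hC hCT),
      fun a ha => cycleFlow_apply_of_notMem fun h => ha (hCT h)⟩
  choose c hcd hc₁ hc₀ using hex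
  -- The inverse of the coordinates: the path flow has all its coordinates off `T` equal to `0`, and
  -- the fundamental circulations are dual to these coordinates.
  let P : ({e : G.Edge // e ∉ T} → ℝ) → G.affineSpace := fun y =>
    ⟨flow σ (G.pathSign G.x₀ G.δ σ) + ∑ i, y i • c i,
      add_mem_affineSpace (hT.flow_pathSign_mem hσ hσT) fun x => by
        rw [map_sum]; exact Finset.sum_eq_zero fun i _ => by rw [map_smul, hcd, smul_zero]⟩
  have hright : ∀ y (e : {e : G.Edge // e ∉ T}), (P y).1 e.1 = y e := fun y e => by
    simp only [P, Pi.add_apply, Finset.sum_apply, Pi.smul_apply, smul_eq_mul]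
    rw [flow, if_neg fun h => e.2 (hσT h), zero_add, Finset.sum_eq_single e, hc₁, mul_one]
    · intro i _ hi
      rw [hc₀ i e.1, mul_zero]
      simp only [Finset.mem_insert, not_or]
      exact ⟨fun h => hi (Subtype.ext h.symm), e.2⟩
    · simp
  refine ⟨⟨⟨fun z e => z.1 e.1, P, fun z => Subtype.ext ?_, fun y => funext (hright y)⟩, ?_, ?_⟩,
    fun _ _ => rfl⟩
  · exact hT.eq_of_eqOn_compl (divMap_eq_of_mem_affineSpace (P _).2 z.2)
      fun a ha => hright _ ⟨a, ha⟩
  · exact measurable_pi_lambda _ fun e => (measurable_pi_apply e.1).comp measurable_subtype_coe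
  · refine Measurable.subtype_mk (measurable_pi_lambda _ fun a => ?_)
    simp only [Pi.add_apply, Finset.sum_apply, Pi.smul_apply, smul_eq_mul]
    fun_prop

/-- The affine space is parametrized by lines in the direction of the fundamental cycle of `e₀`,
in such a way that the volume forms of all the spanning trees obtained from `T` by an exchange
along this cycle are the standard one. -/
lemma IsSpanningTree.exists_parametrization [Fintype V] {T : Finset G.Edge}
    (hT : G.IsSpanningTree T) {e₀ : G.Edge} {C : Finset G.Edge} (hC : G.IsCycle C)
    (hCT : C ⊆ insert e₀ T) {ε : G.Edge → ℤ} (hε : G.IsCycleOrientation C ε) :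
    ∃ (b : ({e : G.Edge // e ∉ insert e₀ T} → ℝ) → G.Edge → ℝ)
      (P : ({e : G.Edge // e ∉ insert e₀ T} → ℝ) × ℝ → G.affineSpace),
      Measurable P ∧ (∀ x, (P x).1 = b x.1 + x.2 • cycleFlow C ε e₀) ∧
      ∀ e ∈ C, MeasurePreserving P volume (G.coordVolume ((insert e₀ T).erase e)) := by
  classical
  obtain ⟨F, hF⟩ := hT.exists_measurableEquiv
  have he₀C := hT.mem_of_subset_insert hC hCT
  -- The base point of each line is its point with `z_{e₀} = 0`.
  let b : ({e : G.Edge // e ∉ insert e₀ T} → ℝ) → G.affineSpace := fun w =>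
    F.symm fun e => if h : e.1 ∈ insert e₀ T then 0 else w ⟨e.1, h⟩
  have hbm : Measurable b := F.symm.measurable.comp <| measurable_pi_lambda _ fun e => by
    by_cases h : e.1 ∈ insert e₀ T <;> simp only [h, dite_true, dite_false] <;> fun_prop
  have hb : ∀ w (e : {e : G.Edge // e ∉ insert e₀ T}), (b w).1 e.1 = w e := fun w e => by
    have heT : e.1 ∉ T := fun h => e.2 (Finset.mem_insert_of_mem h)
    have := hF (b w) ⟨e.1, heT⟩
    rw [← this, F.apply_symm_apply]
    exact dif_neg e.2
  let P : ({e : G.Edge // e ∉ insert e₀ T} → ℝ) × ℝ → G.affineSpace := fun x =>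
    ⟨(b x.1).1 + x.2 • cycleFlow C ε e₀, add_mem_affineSpace (b x.1).2 fun u => by
      rw [map_smul, hε.divMap_cycleFlow, smul_zero]⟩
  have hPm : Measurable P := by
    refine Measurable.subtype_mk (measurable_pi_lambda _ fun a => ?_)
    have : Measurable fun w => (b w).1 a :=
      (measurable_pi_apply a).comp (measurable_subtype_coe.comp hbm)
    simp only [Pi.add_apply, Pi.smul_apply, smul_eq_mul]
    exact (this.comp measurable_fst).add (measurable_snd.mul_const _)
  refine ⟨fun w => (b w).1, P, hPm, fun _ => rfl, fun e he => ⟨hPm, ?_⟩⟩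
  obtain ⟨F', hF'⟩ := (hT.exchange hC hCT he).exists_measurableEquiv
  -- In the coordinates of the exchanged tree, moving along the line changes only the coordinate at
  -- `e`, with speed `c_e = ±1`; the others are the components of `x.1`.
  have hQ : MeasurePreserving (fun x => F' (P x)) volume volume := by
    refine measurePreserving_pi_of_option_shear
      (j := fun k => ⟨k.1, fun h => k.2 (Finset.mem_of_mem_erase h)⟩)
      (i₀ := ⟨e, Finset.notMem_erase e _⟩) (h := fun w => (b w).1 e) ?_ ?_
      (hε.cycleFlow_eq_or he₀C he) ?_ ?_
    · constructor
      · rintro (_ | k) (_ | l) h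
        · rfl
        · simp only [Option.elim, Subtype.mk.injEq] at h
          exact absurd (hCT he) (h ▸ l.2)
        · simp only [Option.elim, Subtype.mk.injEq] at h
          exact absurd (hCT he) (h ▸ k.2)
        · simp only [Option.elim, Subtype.mk.injEq] at h
          rw [Subtype.ext h]
      · rintro ⟨a, ha⟩
        by_cases hae : a = e
        · exact ⟨none, by simp [hae]⟩
        · exact ⟨some ⟨a, fun h => ha (Finset.mem_erase.2 ⟨hae, h⟩)⟩, rfl⟩
    · exact (measurable_pi_apply e).comp (measurable_subtype_coe.comp hbm)
    · intro x
      rw [hF']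
      rfl
    · intro x k
      rw [hF']
      simp only [P, Pi.add_apply, Pi.smul_apply, hb]
      rw [cycleFlow_apply_of_notMem fun h => k.2 (hCT h), smul_zero, add_zero]
  have hcv : G.coordVolume ((insert e₀ T).erase e) = Measure.map F'.symm volume := by
    rw [F'.map_symm, coordVolume]
    congr 1
    funext z e
    exact (hF' z e).symm
  rw [hcv, ← hQ.map_eq, Measure.map_map F'.symm.measurable hQ.measurable]
  congr 1
  funext x
  simp

end PreGraph

namespace PreGraph

variable {V : Type*} {G : PreGraph V}

/-! ### The integrand -/

lemma measurable_integrand (α : G.Edge → ℝ) (T : Finset G.Edge) (l : G.Edge → ℂ) :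
    Measurable (G.integrand α T l) := by
  have hz : ∀ e, Measurable fun z : G.affineSpace => z.1 e := fun e =>
    (measurable_pi_apply e).comp measurable_subtype_coe
  unfold integrand
  refine Measurable.mul (Complex.measurable_exp.comp (Measurable.neg ?_))
    (Complex.measurable_ofReal.comp (Measurable.mul ?_ ?_))
  · exact Finset.measurable_sum _ fun e _ => (Complex.measurable_ofReal.comp (hz e)).const_mul _
  · exact Finset.measurable_prod _ fun e _ => (hz e).pow_const _
  · exact Finset.measurable_prod _ fun e _ => (hz e).inv

lemma measurableSet_chamber (G : PreGraph V) : MeasurableSet G.chamber := by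
  have : G.chamber = ⋂ e, {z | 0 < z.1 e} := by ext; simp [chamber]
  rw [this]
  exact MeasurableSet.iInter fun e => measurableSet_lt measurable_const
    ((measurable_pi_apply e).comp measurable_subtype_coe)

/-- Erasing `e` puts it in the complement and adds one factor `z_e⁻¹`. It is applied with `S = T ∪
{e₀}`, which is not a tree but is common to all the exchanges. -/
lemma integrand_erase (α : G.Edge → ℝ) {S : Finset G.Edge} {e : G.Edge} (he : e ∈ S)
    (l : G.Edge → ℂ) (z : G.affineSpace) :
    G.integrand α (S.erase e) l z = G.integrand α S l z / (z.1 e : ℂ) := by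
  unfold integrand
  rw [Finset.compl_erase, Finset.prod_insert (by simpa using he)]
  push_cast
  rw [div_eq_mul_inv]
  ring

lemma norm_integrand (α : G.Edge → ℝ) (T : Finset G.Edge) (l : G.Edge → ℂ) (z : G.affineSpace) :
    ‖G.integrand α T l z‖ = Real.exp (-∑ e, (l e).re * z.1 e) *
      |(∏ e, (z.1 e) ^ (α e)) * ∏ e ∈ Tᶜ, (z.1 e)⁻¹| := by
  rw [integrand, norm_mul, Complex.norm_real, Real.norm_eq_abs, Complex.norm_exp]
  simp

/-- Half of the exponential decay absorbs the factor `z_a`, since `m_a z_a ≤ exp (∑ m_e z_e)`. The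
bound does not depend on `l`, so it also serves as the majorant for differentiation. -/
lemma mul_norm_integrand_le (α : G.Edge → ℝ) (T : Finset G.Edge) {l : G.Edge → ℂ} {m : G.Edge → ℝ}
    (hm : ∀ e, 0 < m e) (hl : ∀ e, 2 * m e ≤ (l e).re) {z : G.affineSpace} (hz : z ∈ G.chamber)
    (a : G.Edge) : z.1 a * ‖G.integrand α T l z‖ ≤
      (m a)⁻¹ * ‖G.integrand α T (fun e => (m e : ℂ)) z‖ := by
  rw [norm_integrand, norm_integrand, ← mul_assoc, ← mul_assoc]
  refine mul_le_mul_of_nonneg_right ?_ (abs_nonneg _)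
  simp only [Complex.ofReal_re]
  have hz' : ∀ e, 0 < z.1 e := hz
  have h1 : m a * z.1 a ≤ Real.exp (∑ e, m e * z.1 e) :=
    calc m a * z.1 a ≤ ∑ e, m e * z.1 e :=
          Finset.single_le_sum (f := fun e => m e * z.1 e)
            (fun e _ => (mul_pos (hm e) (hz' e)).le) (Finset.mem_univ a)
      _ ≤ _ := by linarith [Real.add_one_le_exp (∑ e, m e * z.1 e)]
  have h2 : Real.exp (-∑ e, (l e).re * z.1 e) ≤
      Real.exp (-∑ e, m e * z.1 e) * Real.exp (-∑ e, m e * z.1 e) := by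
    rw [← Real.exp_add]
    refine Real.exp_le_exp.2 ?_
    have : ∑ e, 2 * m e * z.1 e ≤ ∑ e, (l e).re * z.1 e :=
      Finset.sum_le_sum fun e _ => mul_le_mul_of_nonneg_right (hl e) (hz' e).le
    simp only [mul_assoc, ← Finset.mul_sum] at this
    linarith
  calc z.1 a * Real.exp (-∑ e, (l e).re * z.1 e)
      ≤ z.1 a * (Real.exp (-∑ e, m e * z.1 e) * Real.exp (-∑ e, m e * z.1 e)) := by
        gcongr; exact (hz' a).le
    _ = (m a)⁻¹ * (m a * z.1 a) * (Real.exp (-∑ e, m e * z.1 e) *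
          Real.exp (-∑ e, m e * z.1 e)) := by
        rw [inv_mul_cancel_left₀ (hm a).ne']
    _ ≤ (m a)⁻¹ * Real.exp (∑ e, m e * z.1 e) * (Real.exp (-∑ e, m e * z.1 e) *
          Real.exp (-∑ e, m e * z.1 e)) := by
        have := (inv_pos.2 (hm a)).le
        gcongr
    _ = (m a)⁻¹ * Real.exp (-∑ e, m e * z.1 e) := by
        rw [mul_assoc, ← mul_assoc (Real.exp _), ← Real.exp_add, add_neg_cancel, Real.exp_zero,
          one_mul]

lemma IntegralsWellDefined.integrableOn_mul {α : G.Edge → ℝ} (hα : G.IntegralsWellDefined α)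
    (T : G.SpanningTree) {l : G.Edge → ℂ} (hl : l ∈ G.rightDomain) (a : G.Edge) :
    IntegrableOn (fun z => (z.1 a : ℂ) * G.integrand α T.1 l z) G.chamber
      (G.coordVolume T.1) := by
  have hl' : ∀ e, 0 < (l e).re := hl
  have hm : (fun e => (((l e).re / 2 : ℝ) : ℂ)) ∈ G.rightDomain := fun e => by
    rw [Complex.ofReal_re]; exact half_pos (hl' e)
  refine Integrable.mono' ((hα T _ hm).norm.const_mul ((l a).re / 2)⁻¹) ?_ ?_
  · exact ((Complex.measurable_ofReal.comp ((measurable_pi_apply a).comp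
      measurable_subtype_coe)).mul (measurable_integrand α T.1 l)).aestronglyMeasurable
  · refine (ae_restrict_iff' (measurableSet_chamber G)).2 (ae_of_all _ fun z hz => ?_)
    rw [norm_mul, Complex.norm_real, Real.norm_eq_abs, abs_of_pos (hz a)]
    exact mul_norm_integrand_le α T.1 (m := fun e => (l e).re / 2) (fun e => half_pos (hl' e))
      (fun e => by linarith) hz a

/-- The function `exp (-⟨l, z⟩) ∏_e z_e ^ β_e` for positive `z`. -/
noncomputable def expMonomial (l : G.Edge → ℂ) (β : G.Edge → ℝ) (z : G.Edge → ℝ) : ℂ :=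
  Complex.exp (-∑ e, l e * (z e : ℂ) + ∑ e, (β e : ℂ) * (Real.log (z e) : ℂ))

lemma integrand_eq_expMonomial (α : G.Edge → ℝ) (S : Finset G.Edge) (l : G.Edge → ℂ)
    {z : G.affineSpace} (hz : z ∈ G.chamber) : G.integrand α S l z =
      expMonomial l (fun e => α e - if e ∈ S then 0 else 1) z.1 := by
  have hz' : ∀ e, 0 < z.1 e := hz
  rw [integrand, expMonomial, Complex.exp_add]
  congr 1
  simp_rw [← Complex.ofReal_mul]
  rw [← Complex.ofReal_sum, ← Complex.ofReal_exp, Real.exp_sum]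
  congr 1
  have hS : ∏ e ∈ Sᶜ, (z.1 e)⁻¹ = ∏ e, if e ∈ S then 1 else (z.1 e)⁻¹ := by
    rw [Finset.prod_ite, Finset.prod_const_one, one_mul]
    congr 1
    ext
    simp
  rw [hS, ← Finset.prod_mul_distrib]
  refine Finset.prod_congr rfl fun e _ => ?_
  rw [mul_comm _ (Real.log _), ← Real.rpow_def_of_pos (hz' e)]
  split_ifs
  · simp
  · rw [Real.rpow_sub_one (hz' e).ne', div_eq_mul_inv]

lemma hasDerivAt_expMonomial (l : G.Edge → ℂ) (β b c : G.Edge → ℝ) {t : ℝ}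
    (ht : ∀ e, 0 < b e + t * c e) :
    HasDerivAt (fun s : ℝ => expMonomial l β (b + s • c))
      (expMonomial l β (b + t • c) * (-∑ e, l e * c e +
        ∑ e, (β e * c e : ℂ) / ((b e + t * c e : ℝ) : ℂ))) t := by
  have hp : ∀ e, HasDerivAt (fun s : ℝ => b e + s * c e) (c e) t := fun e => by
    have h := ((hasDerivAt_id t).mul_const (c e)).const_add (b e)
    rwa [one_mul] at h
  have h1 : HasDerivAt (fun s : ℝ => ∑ e, l e * ((b e + s * c e : ℝ) : ℂ)) (∑ e, l e * c e) t :=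
    HasDerivAt.fun_sum fun e _ => (hp e).ofReal_comp.const_mul (l e)
  have h2 : HasDerivAt (fun s : ℝ => ∑ e, (β e : ℂ) * (Real.log (b e + s * c e) : ℂ))
      (∑ e, (β e : ℂ) * ((c e / (b e + t * c e) : ℝ) : ℂ)) t :=
    HasDerivAt.fun_sum fun e _ => ((hp e).log (ht e).ne').ofReal_comp.const_mul (β e : ℂ)
  have h3 := (h1.neg.add h2).cexp
  convert h3 using 1
  simp only [expMonomial, Pi.add_apply, Pi.smul_apply, smul_eq_mul, Pi.neg_apply]
  have h4 : ∀ e, (β e * c e : ℂ) / ((b e + t * c e : ℝ) : ℂ) =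
      (β e : ℂ) * ((c e / (b e + t * c e) : ℝ) : ℂ) := fun e => by
    push_cast
    ring
  simp only [h4]
  rfl

/-! ### Integration by parts along a fundamental cycle -/

lemma IsSpanningTree.sum_cycleFlow_mul_integral [Fintype V] {T : Finset G.Edge}
    (hT : G.IsSpanningTree T) {e₀ : G.Edge} (he₀ : e₀ ∉ T) {C : Finset G.Edge} (hC : G.IsCycle C)
    (hCT : C ⊆ insert e₀ T) {ε : G.Edge → ℤ} (hε : G.IsCycleOrientation C ε)
    {α : G.Edge → ℝ} (hα : G.IntegralsWellDefined α) {l : G.Edge → ℂ} (hl : l ∈ G.rightDomain) :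
    (∑ e, l e * cycleFlow C ε e₀ e) *
        ∫ z in G.chamber, (z.1 e₀ : ℂ) * G.integrand α T l z ∂(G.coordVolume T) =
      ∑ e ∈ C, ((α e * cycleFlow C ε e₀ e : ℝ) : ℂ) *
        ∫ z in G.chamber, G.integrand α ((insert e₀ T).erase e) l z
          ∂(G.coordVolume ((insert e₀ T).erase e)) := by
  classical
  have hpar := hT.exists_parametrization hC hCT hε
  have hex : ∀ e ∈ C, G.IsSpanningTree ((insert e₀ T).erase e) := fun e he =>
    hT.exchange hC hCT he
  have he₀C := hT.mem_of_subset_insert hC hCT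
  have hST : (insert e₀ T).erase e₀ = T := Finset.erase_insert he₀
  generalize insert e₀ T = S at hCT hpar hex hST ⊢
  obtain ⟨b, P, hPm, hPb, hP⟩ := hpar
  set c := cycleFlow C ε e₀ with hc
  set D := P ⁻¹' G.chamber with hD
  have hDm : MeasurableSet D := hPm (measurableSet_chamber G)
  set β : G.Edge → ℝ := fun e => α e - if e ∈ S then 0 else 1 with hβ
  set g : ({e : G.Edge // e ∉ S} → ℝ) × ℝ → ℂ := fun x => expMonomial l β (P x).1 with hg
  have hgP : ∀ x ∈ D, G.integrand α S l (P x) = g x := fun x hx =>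
    integrand_eq_expMonomial α S l hx
  have hpres : ∀ e ∈ C, MeasurePreserving P (volume.restrict D)
      ((G.coordVolume (S.erase e)).restrict G.chamber) := fun e he =>
    (hP e he).restrict_preimage (measurableSet_chamber G)
  have transfer_int : ∀ e ∈ C, ∀ F : G.affineSpace → ℂ, Measurable F →
      ∫ z in G.chamber, F z ∂(G.coordVolume (S.erase e)) = ∫ x in D, F (P x) :=
    fun e he F hF => by
      rw [← (hpres e he).map_eq]
      exact integral_map hPm.aemeasurable hF.aestronglyMeasurable
  have transfer : ∀ e ∈ C, ∀ F : G.affineSpace → ℂ, Measurable F →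
      IntegrableOn F G.chamber (G.coordVolume (S.erase e)) →
      IntegrableOn (fun x => F (P x)) D := fun e he F hF h =>
    ((hpres e he).integrable_comp hF.aestronglyMeasurable).2 h
  have hcoord : ∀ e, Measurable fun z : G.affineSpace => (z.1 e : ℂ) := fun e =>
    Complex.measurable_ofReal.comp ((measurable_pi_apply e).comp measurable_subtype_coe)
  have hdiv : ∀ e ∈ C, ∀ x ∈ D,
      G.integrand α (S.erase e) l (P x) = g x / ((P x).1 e : ℂ) := fun e he x hx => by
    rw [integrand_erase α (hCT he), hgP x hx]
  have hmul : ∀ x ∈ D, ((P x).1 e₀ : ℂ) * G.integrand α T l (P x) = g x := fun x hx => by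
    have hne : ((P x).1 e₀ : ℂ) ≠ 0 := Complex.ofReal_ne_zero.2 (ne_of_gt (hx e₀))
    rw [← hST, hdiv e₀ he₀C x hx, mul_div_cancel₀ _ hne]
  have hgi : IntegrableOn g D := by
    refine (transfer e₀ he₀C (fun z => (z.1 e₀ : ℂ) * G.integrand α T l z)
      ((hcoord e₀).mul (measurable_integrand α T l)) ?_).congr_fun hmul hDm
    rw [hST]
    exact hα.integrableOn_mul ⟨T, hT⟩ hl e₀
  -- The assumed convergence for the tree `S \ {e}` is the integrability of `g / z_e` that controls
  -- the boundary terms.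
  have hgdi : ∀ e ∈ C, IntegrableOn (fun x => g x / ((P x).1 e : ℂ)) D := fun e he =>
    (transfer e he _ (measurable_integrand α _ l)
      (hα ⟨_, hex e he⟩ l hl)).congr_fun (hdiv e he) hDm
  have hI₀ : ∫ z in G.chamber, (z.1 e₀ : ℂ) * G.integrand α T l z ∂(G.coordVolume T) =
      ∫ x in D, g x := by
    have := transfer_int e₀ he₀C (fun z => (z.1 e₀ : ℂ) * G.integrand α T l z)
      ((hcoord e₀).mul (measurable_integrand α T l))
    rw [hST] at this
    rw [this]
    exact setIntegral_congr_fun hDm hmul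
  have hI : ∀ e ∈ C, ∫ z in G.chamber, G.integrand α (S.erase e) l z
      ∂(G.coordVolume (S.erase e)) = ∫ x in D, g x / ((P x).1 e : ℂ) := fun e he => by
    rw [transfer_int e he _ (measurable_integrand α _ l)]
    exact setIntegral_congr_fun hDm (hdiv e he)
  -- On `D`, the derivative of `g` along the lines of direction `c`.
  let g' : ({e : G.Edge // e ∉ S} → ℝ) × ℝ → ℂ := fun x =>
    -(∑ e, l e * c e) * g x + ∑ e ∈ C, ((α e * c e : ℝ) : ℂ) * (g x / ((P x).1 e : ℂ))
  have hsumi : IntegrableOn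
      (fun x => ∑ e ∈ C, ((α e * c e : ℝ) : ℂ) * (g x / ((P x).1 e : ℂ))) D :=
    integrable_finsetSum _ fun e he => (hgdi e he).const_mul _
  have hg'i : IntegrableOn g' D := (hgi.const_mul _).add hsumi
  have hzero : ∫ x in D, g' x = 0 := by
    rw [← integral_indicator hDm, Measure.volume_eq_prod,
      integral_prod _ (hg'i.integrable_indicator hDm)]
    -- By Fubini the integrability conditions pass to almost every line, where the one-dimensional
    -- statement applies.
    have hsec : ∀ F : ({e : G.Edge // e ∉ S} → ℝ) × ℝ → ℂ, IntegrableOn F D →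
        ∀ᵐ w, IntegrableOn (fun t => F (w, t)) {t | (w, t) ∈ D} := fun F hF => by
      have := (hF.integrable_indicator hDm).prod_right_ae
      filter_upwards [this] with w hw
      exact (integrable_indicator_iff (measurable_prodMk_left hDm)).1 hw
    have hsecd : ∀ᵐ w, ∀ e ∈ C,
        IntegrableOn (fun t => g (w, t) / ((P (w, t)).1 e : ℂ)) {t | (w, t) ∈ D} :=
      (Finset.eventually_all C).2 fun e he => hsec _ (hgdi e he)
    refine integral_eq_zero_of_ae ?_
    filter_upwards [hsec _ hgi, hsec _ hg'i, hsecd] with w hw hw' hwd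
    have hPe : ∀ t e, (P (w, t)).1 e = b w e + t * c e := fun t e => by
      rw [hPb]; rfl
    have hJ : {t | (w, t) ∈ D} = {t | ∀ e, 0 < b w e + t * c e} := by
      ext t
      simp only [← hPe]
      rfl
    have hgw : (fun t => g (w, t)) = fun t => expMonomial l β (b w + t • c) := by
      funext t
      simp only [hg, hPb]
    refine Eq.trans ?_ (integral_deriv_eq_zero_of_integrableOn_div (b w) c hJ
      (f := fun t => g (w, t)) (f' := fun t => g' (w, t)) ?_ hw hw' ?_)
    · exact integral_indicator (f := fun t => g' (w, t)) (measurable_prodMk_left hDm)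
    · intro t ht
      rw [hJ] at ht
      rw [hgw]
      convert hasDerivAt_expMonomial l β (b w) c ht using 1
      have h1 : expMonomial l β (b w + t • c) = g (w, t) := (congrFun hgw t).symm
      rw [h1, mul_add, Finset.mul_sum]
      simp only [g', hPe]
      rw [mul_comm (g (w, t))]
      congr 1
      symm
      refine (Finset.sum_subset (Finset.subset_univ C) fun e _ he => ?_).symm.trans
        (Finset.sum_congr rfl fun e he => ?_)
      · rw [hc, cycleFlow_apply_of_notMem he]
        simp
      -- The exponents lowered by `1` belong to edges outside `S ⊇ C`, which the direction `c` does
      -- not see.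
      · rw [show β e = α e by simp [hβ, hCT he]]
        push_cast
        ring
    · intro e he
      have heC : e ∈ C := by_contra fun h => he (cycleFlow_apply_of_notMem h)
      simpa only [hPe] using hwd e heC
  have hsplit : ∫ x in D, g' x = -(∑ e, l e * c e) * (∫ x in D, g x) +
      ∑ e ∈ C, ((α e * c e : ℝ) : ℂ) * ∫ x in D, g x / ((P x).1 e : ℂ) := by
    rw [integral_add (hgi.const_mul _) hsumi, integral_const_mul,
      integral_finsetSum _ fun e he => (hgdi e he).const_mul _]
    simp only [integral_const_mul]
  rw [hI₀, Finset.sum_congr (s₁ := C) rfl fun e he => congrArg _ (hI e he)]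
  rw [hsplit, neg_mul, neg_add_eq_zero] at hzero
  exact hzero

end PreGraph

namespace PreGraph

variable {V : Type*} {G : PreGraph V}

/-! ### Differentiation under the integral sign -/

/-- The moment `∫ z_a exp (-⟨l, z⟩) ∏_e z_e ^ α_e ω_T`. -/
noncomputable def moment (α : G.Edge → ℝ) (T : Finset G.Edge) (l : G.Edge → ℂ) (a : G.Edge) : ℂ :=
  ∫ z in G.chamber, (z.1 a : ℂ) * G.integrand α T l z ∂(G.coordVolume T)

lemma hasFDerivAt_integrand (α : G.Edge → ℝ) (T : Finset G.Edge) (l : G.Edge → ℂ)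
    (z : G.affineSpace) : HasFDerivAt (fun l => G.integrand α T l z)
      (-∑ a, ((z.1 a : ℂ) * G.integrand α T l z) •
        (ContinuousLinearMap.proj a : (G.Edge → ℂ) →L[ℂ] ℂ)) l := by
  have h1 : HasFDerivAt (fun l : G.Edge → ℂ => ∑ e, l e * (z.1 e : ℂ))
      (∑ a, (z.1 a : ℂ) • (ContinuousLinearMap.proj a : (G.Edge → ℂ) →L[ℂ] ℂ)) l :=
    HasFDerivAt.fun_sum fun a _ =>
      (ContinuousLinearMap.proj (R := ℂ) (φ := fun _ : G.Edge => ℂ) a).hasFDerivAt.mul_const _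
  have h2 := h1.neg.cexp.mul_const
    (((∏ e, (z.1 e) ^ (α e)) * ∏ e ∈ Tᶜ, (z.1 e)⁻¹ : ℝ) : ℂ)
  refine h2.congr_fderiv ?_
  ext v
  simp only [integrand, _root_.smul_apply, _root_.neg_apply,
    _root_.sum_apply, ContinuousLinearMap.proj_apply, smul_eq_mul, Pi.neg_apply,
    mul_neg, Finset.mul_sum]
  congr 1
  refine Finset.sum_congr rfl fun a _ => ?_
  ring

lemma IntegralsWellDefined.hasFDerivAt_integral {α : G.Edge → ℝ} (hα : G.IntegralsWellDefined α)
    (T : G.SpanningTree) {l : G.Edge → ℂ} (hl : l ∈ G.rightDomain) :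
    HasFDerivAt (fun l => G.hyperInt α l T)
      (-∑ a, moment α T.1 l a • (ContinuousLinearMap.proj a : (G.Edge → ℂ) →L[ℂ] ℂ)) l := by
  have hl' : ∀ e, 0 < (l e).re := hl
  -- With a quarter, `2 * m e < (l e).re` strictly, so the condition `2 * m e ≤ (l' e).re` holds
  -- near `l`.
  let m : G.Edge → ℝ := fun e => (l e).re / 4
  have hm : ∀ e, 0 < m e := fun e => by have := hl' e; positivity
  have hs : {l' : G.Edge → ℂ | ∀ e, 2 * m e ≤ (l' e).re} ∈ 𝓝 l := by
    refine eventually_all.2 fun e => ?_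
    have hc : ContinuousAt (fun l' : G.Edge → ℂ => (l' e).re) l :=
      (Complex.continuous_re.comp (continuous_apply e)).continuousAt
    filter_upwards [hc.eventually (lt_mem_nhds (show 2 * m e < (l e).re by
      have := hl' e; simp only [m]; linarith))] with l' h using h.le
  have hmdom : (fun e => (m e : ℂ)) ∈ G.rightDomain := fun e => by
    rw [Complex.ofReal_re]; exact hm e
  have hcoord : ∀ e, Measurable fun z : G.affineSpace => (z.1 e : ℂ) := fun e =>
    Complex.measurable_ofReal.comp ((measurable_pi_apply e).comp measurable_subtype_coe)
  have hmain := hasFDerivAt_integral_of_dominated_of_fderiv_le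
    (μ := (G.coordVolume T.1).restrict G.chamber) (F := fun l z => G.integrand α T.1 l z)
    (F' := fun l z => -∑ a, ((z.1 a : ℂ) * G.integrand α T.1 l z) •
        (ContinuousLinearMap.proj a : (G.Edge → ℂ) →L[ℂ] ℂ))
    (bound := fun z => ∑ a, (m a)⁻¹ * ‖G.integrand α T.1 (fun e => (m e : ℂ)) z‖)
    hs (Eventually.of_forall fun l => (measurable_integrand α T.1 l).aestronglyMeasurable)
    (hα T l hl) ?_ ?_ ?_ ?_
  · refine hmain.congr_fderiv ?_
    have hi : ∀ a, Integrable (fun z : G.affineSpace => ((z.1 a : ℂ) * G.integrand α T.1 l z) •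
        (ContinuousLinearMap.proj a : (G.Edge → ℂ) →L[ℂ] ℂ))
        ((G.coordVolume T.1).restrict G.chamber) := fun a =>
      (hα.integrableOn_mul T hl a).smul_const _
    rw [integral_neg, integral_finsetSum _ fun a _ => hi a]
    simp only [integral_smul_const]
    rfl
  · refine AEStronglyMeasurable.neg (Finset.aestronglyMeasurable_fun_sum _ fun a _ => ?_)
    exact ((hcoord a).mul (measurable_integrand α T.1 l)).aestronglyMeasurable.smul_const _
  · refine (ae_restrict_iff' (measurableSet_chamber G)).2 (ae_of_all _ fun z hz l' hl' => ?_)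
    rw [norm_neg]
    refine (norm_sum_le _ _).trans (Finset.sum_le_sum fun a _ => ?_)
    rw [norm_smul, norm_mul, Complex.norm_real, Real.norm_eq_abs, abs_of_pos (hz a)]
    refine le_trans (mul_le_of_le_one_right (mul_nonneg (hz a).le (norm_nonneg _)) ?_)
      (mul_norm_integrand_le α T.1 hm hl' hz a)
    exact ContinuousLinearMap.opNorm_le_bound _ zero_le_one fun v => by
      rw [one_mul]; exact norm_le_pi_norm v a
  · exact integrable_finsetSum _ fun a _ => (hα T _ hmdom).norm.const_mul _
  · exact ae_of_all _ fun z l' _ => hasFDerivAt_integrand α T.1 l' z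

/-! ### The linear system for the moments -/

lemma sum_mul_flow (S : Finset G.Edge) (ε : G.Edge → ℤ) (v : G.Edge → ℂ) :
    ∑ a, v a * (flow S ε a : ℂ) = G.linForm S ε v := by
  simp only [flow, linForm, LinearMap.coe_sum, Finset.sum_apply, LinearMap.smul_apply,
    LinearMap.proj_apply, smul_eq_mul]
  rw [← Finset.sum_subset (Finset.subset_univ S)]
  · refine Finset.sum_congr rfl fun a ha => ?_
    rw [if_pos ha, mul_comm]
    push_cast
    rfl
  · intro a _ ha
    rw [if_neg ha]
    simp

lemma sum_mul_cycleFlow (C : Finset G.Edge) (ε : G.Edge → ℤ) (e₀ : G.Edge) (v : G.Edge → ℂ) :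
    ∑ a, v a * (cycleFlow C ε e₀ a : ℂ) = ε e₀ * G.linForm C ε v := by
  rw [← sum_mul_flow, Finset.mul_sum]
  refine Finset.sum_congr rfl fun a _ => ?_
  simp only [cycleFlow, Pi.smul_apply, smul_eq_mul]
  push_cast
  ring

/-- The tree decomposition of `z`, integrated coordinate by coordinate and paired with `v`: only the
moments at edges off `T` remain. -/
lemma IsSpanningTree.sum_moment [Fintype V] {T : Finset G.Edge} (hT : G.IsSpanningTree T)
    {σ : Finset G.Edge} (hσ : G.IsSimplePath G.x₀ G.δ σ) (hσT : σ ⊆ T)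
    {C : G.Edge → Finset G.Edge} (hC : ∀ e₀, e₀ ∉ T → G.IsCycle (C e₀))
    (hCT : ∀ e₀, e₀ ∉ T → C e₀ ⊆ insert e₀ T)
    {ε : Finset G.Edge → G.Edge → ℤ} (hε : ∀ C, G.IsCycle C → G.IsCycleOrientation C (ε C))
    {α : G.Edge → ℝ} (hα : G.IntegralsWellDefined α) {l : G.Edge → ℂ} (hl : l ∈ G.rightDomain)
    (v : G.Edge → ℂ) :
    ∑ a, moment α T l a * v a =
      G.linForm σ (G.pathSign G.x₀ G.δ σ) v * G.hyperInt α l ⟨T, hT⟩ +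
        ∑ e₀ ∈ Tᶜ, (ε (C e₀) e₀ * G.linForm (C e₀) (ε (C e₀)) v) * moment α T l e₀ := by
  have hdec : ∀ z : G.affineSpace, z.1 = flow σ (G.pathSign G.x₀ G.δ σ) +
      ∑ e₀ ∈ Tᶜ, z.1 e₀ • cycleFlow (C e₀) (ε (C e₀)) e₀ := fun z =>
    hT.eq_flow_add_sum (hT.flow_pathSign_mem hσ hσT) (fun a ha => if_neg fun h => ha (hσT h))
      (fun e₀ h => (hε _ (hC e₀ h)).divMap_cycleFlow e₀)
      (fun e₀ h => (hε _ (hC e₀ h)).cycleFlow_self (hT.mem_of_subset_insert (hC e₀ h) (hCT e₀ h)))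
      (fun e₀ h a ha => cycleFlow_apply_of_notMem fun h' => ha (hCT e₀ h h')) z.2
  have hmom : ∀ a, moment α T l a =
      flow σ (G.pathSign G.x₀ G.δ σ) a * G.hyperInt α l ⟨T, hT⟩ +
        ∑ e₀ ∈ Tᶜ, (cycleFlow (C e₀) (ε (C e₀)) e₀ a : ℂ) * moment α T l e₀ := fun a => by
    have hz : ∀ z : G.affineSpace, (z.1 a : ℂ) * G.integrand α T l z =
        flow σ (G.pathSign G.x₀ G.δ σ) a * G.integrand α T l z +
          ∑ e₀ ∈ Tᶜ, (cycleFlow (C e₀) (ε (C e₀)) e₀ a : ℂ) *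
            ((z.1 e₀ : ℂ) * G.integrand α T l z) := fun z => by
      have h := congrArg (fun r : ℝ => (r : ℂ)) (congrFun (hdec z) a)
      simp only [Pi.add_apply, Finset.sum_apply, Pi.smul_apply, smul_eq_mul, Complex.ofReal_add,
        Complex.ofReal_sum, Complex.ofReal_mul] at h
      rw [h, add_mul, Finset.sum_mul]
      congr 1
      refine Finset.sum_congr rfl fun e₀ _ => ?_
      ring
    have hi : ∀ e₀ ∈ Tᶜ, Integrable (fun z : G.affineSpace =>
        (cycleFlow (C e₀) (ε (C e₀)) e₀ a : ℂ) * ((z.1 e₀ : ℂ) * G.integrand α T l z))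
        ((G.coordVolume T).restrict G.chamber) := fun e₀ _ =>
      (hα.integrableOn_mul ⟨T, hT⟩ hl e₀).const_mul _
    unfold moment
    simp only [hz]
    rw [integral_add ((hα ⟨T, hT⟩ l hl).const_mul _) (integrable_finsetSum _ hi),
      integral_finsetSum _ hi]
    simp only [integral_const_mul]
    rfl
  calc ∑ a, moment α T l a * v a
      = ∑ a, (flow σ (G.pathSign G.x₀ G.δ σ) a * G.hyperInt α l ⟨T, hT⟩ +
        ∑ e₀ ∈ Tᶜ, (cycleFlow (C e₀) (ε (C e₀)) e₀ a : ℂ) * moment α T l e₀) * v a :=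
        Finset.sum_congr rfl fun a _ => congrArg (· * v a) (hmom a)
    _ = (∑ a, v a * (flow σ (G.pathSign G.x₀ G.δ σ) a : ℂ)) * G.hyperInt α l ⟨T, hT⟩ +
        ∑ e₀ ∈ Tᶜ, (∑ a, v a * (cycleFlow (C e₀) (ε (C e₀)) e₀ a : ℂ)) * moment α T l e₀ := by
        simp only [add_mul, Finset.sum_add_distrib, Finset.sum_mul]
        rw [Finset.sum_comm (s := Tᶜ)]
        congr 1
        · exact Finset.sum_congr rfl fun a _ => by ring
        · exact Finset.sum_congr rfl fun a _ => Finset.sum_congr rfl fun e₀ _ => by ring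
    _ = _ := by simp only [sum_mul_flow, sum_mul_cycleFlow]

lemma sum_treeVec_mul {S : Finset G.Edge} (hS : G.IsSpanningTree S) (I : G.SpanningTree → ℂ) :
    ∑ T, (G.treeVec S T : ℂ) * I T = I ⟨S, hS⟩ := by
  classical
  rw [Finset.sum_eq_single ⟨S, hS⟩]
  · simp [treeVec]
  · intro T _ hT
    rw [treeVec, if_neg fun h => hT (Subtype.ext h)]
    simp
  · simp

lemma mulVec_rowMatrix_OmegaPath (σ : Finset G.Edge) (I : G.SpanningTree → ℂ) (T : G.SpanningTree)
    [Decidable (σ ⊆ T.1)] :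
    (G.rowMatrix (G.OmegaPath σ)).mulVec I T = if σ ⊆ T.1 then I T else 0 := by
  classical
  simp only [Matrix.mulVec, dotProduct, rowMatrix, Matrix.of_apply, OmegaPath,
    ← Pi.basisFun_apply ℝ, Module.Basis.constr_basis]
  split_ifs with h
  · exact sum_treeVec_mul T.2 I
  · simp

lemma mulVec_rowMatrix_OmegaCycle [Fintype V] (α : G.Edge → ℝ) {C : Finset G.Edge}
    (hC : G.IsCycle C) (ε : G.Edge → ℤ) {I : Finset G.Edge → ℂ} (T : G.SpanningTree)
    [DecidablePred fun e₀ => C ⊆ insert e₀ T.1] :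
    (G.rowMatrix (G.OmegaCycle α C ε)).mulVec (fun T' => I T'.1) T =
      ∑ e₀ ∈ T.1ᶜ with C ⊆ insert e₀ T.1,
        ∑ e ∈ C, ((ε e₀ * ε e * α e : ℝ) : ℂ) * I ((insert e₀ T.1).erase e) := by
  classical
  simp only [Matrix.mulVec, dotProduct, rowMatrix, Matrix.of_apply, OmegaCycle,
    ← Pi.basisFun_apply ℝ, Module.Basis.constr_basis, Finset.sum_apply, Pi.smul_apply, smul_eq_mul,
    Complex.ofReal_sum, Finset.sum_mul]
  rw [Finset.sum_comm]
  refine Finset.sum_congr (by ext; simp) fun e₀ he₀ => ?_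
  rw [Finset.sum_comm]
  refine Finset.sum_congr rfl fun e he => ?_
  have hS := T.2.exchange hC (Finset.mem_filter.1 he₀).2 he
  rw [← sum_treeVec_mul hS fun T' => I T'.1, Finset.mul_sum]
  refine Finset.sum_congr rfl fun T' _ => ?_
  push_cast
  ring

/-- The derivative of the integral attached to a spanning tree. -/
lemma sum_moment_eq_mulVec_Omega [Fintype V] {α : G.Edge → ℝ} (hα : G.IntegralsWellDefined α)
    {ε : Finset G.Edge → G.Edge → ℤ} (hε : ∀ C, G.IsCycle C → G.IsCycleOrientation C (ε C))
    {l : G.Edge → ℂ} (hlM : l ∈ G.M ε) (hl : l ∈ G.rightDomain) (v : G.Edge → ℂ)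
    (T : G.SpanningTree) :
    ∑ a, moment α T.1 l a * v a = (G.Omega α ε l v).mulVec (G.hyperInt α l) T := by
  classical
  obtain ⟨σ, hσ, hσT⟩ := T.2.2 _ _ G.x₀_ne_δ
  have hex : ∀ e₀, ∃ C, e₀ ∉ T.1 → G.IsCycle C ∧ C ⊆ insert e₀ T.1 := fun e₀ => by
    by_cases h : e₀ ∈ T.1
    · exact ⟨∅, fun h' => absurd h h'⟩
    · obtain ⟨C, hC⟩ := T.2.exists_isCycle h
      exact ⟨C, fun _ => hC⟩
  choose C hC using hex
  -- Defined for every set of edges, so that exchanged sets can be inserted without a proof that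
  -- they are trees.
  let I : Finset G.Edge → ℂ := fun S =>
    ∫ z in G.chamber, G.integrand α S l z ∂(G.coordVolume S)
  have hI : G.hyperInt α l = fun T' => I T'.1 := rfl
  rw [T.2.sum_moment hσ hσT (fun e₀ h => (hC e₀ h).1) (fun e₀ h => (hC e₀ h).2) hε hα hl v]
  simp only [Omega, LinearMap.add_apply, LinearMap.coe_sum, Finset.sum_apply,
    LinearMap.smulRight_apply, Matrix.add_mulVec, Matrix.sum_mulVec, Matrix.smul_mulVec,
    Pi.add_apply, Pi.smul_apply, LinearMap.smul_apply, smul_eq_mul]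
  congr 1
  · rw [Finset.sum_eq_single σ]
    · rw [mulVec_rowMatrix_OmegaPath, if_pos hσT]
    · intro τ hτ hne
      rw [mulVec_rowMatrix_OmegaPath, if_neg, mul_zero]
      exact fun h => hne (T.2.path_unique (Finset.mem_filter.1 hτ).2 h hσ hσT)
    · intro h
      exact absurd (Finset.mem_filter.2 ⟨Finset.mem_univ σ, hσ⟩) h
  · rw [hI]
    -- A cycle acts nontrivially on `T` only as a fundamental cycle, so the sum over cycles is
    -- rewritten as a sum over the edges `e₀ ∉ T`.
    have hterm : ∀ D ∈ Finset.univ.filter G.IsCycle,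
        (G.linForm D (ε D) l)⁻¹ * G.linForm D (ε D) v *
          (G.rowMatrix (G.OmegaCycle α D (ε D))).mulVec (fun T' => I T'.1) T =
        ∑ e₀ ∈ T.1ᶜ, if D = C e₀ then (G.linForm D (ε D) l)⁻¹ * G.linForm D (ε D) v *
          ∑ e ∈ D, ((ε D e₀ * ε D e * α e : ℝ) : ℂ) * I ((insert e₀ T.1).erase e) else 0 := by
      intro D hD
      have hD' := (Finset.mem_filter.1 hD).2
      rw [mulVec_rowMatrix_OmegaCycle α hD', Finset.mul_sum, Finset.sum_filter]
      refine Finset.sum_congr rfl fun e₀ he₀ => ?_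
      have hC' := hC e₀ (Finset.mem_compl.1 he₀)
      have hiff : D ⊆ insert e₀ T.1 ↔ D = C e₀ :=
        ⟨fun h => T.2.cycle_unique hD' h hC'.1 hC'.2, fun h => h ▸ hC'.2⟩
      simp only [hiff]
    rw [Finset.sum_congr rfl hterm, Finset.sum_comm]
    refine Finset.sum_congr rfl fun e₀ he₀ => ?_
    have he₀' := Finset.mem_compl.1 he₀
    have hC' := hC e₀ he₀'
    -- Avoiding the hyperplanes lets the integration by parts identity be solved for the moment at
    -- `e₀`.
    have hne : G.linForm (C e₀) (ε (C e₀)) l ≠ 0 := hlM (C e₀) hC'.1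
    rw [Finset.sum_ite_eq' (Finset.univ.filter G.IsCycle) (C e₀),
      if_pos (Finset.mem_filter.2 ⟨Finset.mem_univ _, hC'.1⟩)]
    have hparts := T.2.sum_cycleFlow_mul_integral he₀' hC'.1 hC'.2 (hε _ hC'.1) hα hl
    rw [sum_mul_cycleFlow] at hparts
    have hsum : ∑ e ∈ C e₀, ((ε (C e₀) e₀ * ε (C e₀) e * α e : ℝ) : ℂ) *
        I ((insert e₀ T.1).erase e) =
        ε (C e₀) e₀ * G.linForm (C e₀) (ε (C e₀)) l * moment α T.1 l e₀ := by
      refine Eq.trans (Finset.sum_congr rfl fun e he => ?_) hparts.symm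
      rw [cycleFlow_apply_of_mem he, mul_comm (α e)]
    rw [hsum]
    field_simp

end PreGraph

theorem theorem3p1 {V : Type*} [Fintype V] (G : RootedGraph V)
    (α : G.Edge → ℝ) (hα : G.IntegralsWellDefined α)
    (ε : Finset G.Edge → G.Edge → ℤ) (hε : ∀ C, G.IsCycle C → G.IsCycleOrientation C (ε C))
    (l : G.Edge → ℂ) (hl : l ∈ G.M ε ∩ G.rightDomain) :
    DifferentiableAt ℂ (G.hyperInt α) l ∧
      ∀ v : G.Edge → ℂ,
        fderiv ℂ (G.hyperInt α) l v = -((G.Omega α ε l v).mulVec (G.hyperInt α l)) := by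
  have hderiv := hasFDerivAt_pi.2 fun T => hα.hasFDerivAt_integral T hl.2
  refine ⟨hderiv.differentiableAt, fun v => ?_⟩
  rw [hderiv.fderiv]
  funext T
  rw [Pi.neg_apply, ← PreGraph.sum_moment_eq_mulVec_Omega hα hε hl.1 hl.2 v T]
  simp
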